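/- Let $n,p,d$ be natural numbers. A stream is a matrix $x\in\mathbb R^{n\times d}$ with rows $x_1,\dots,x_n$. Let $\mathbf N$ be any set of pairs $(x,\tilde x)$ of streams, called neighboring; for example, for a participation schema $\Pi$ (a set of subsets of $\{1,\dots,n\}$), the pairs that differ only in the norm-bounded contributions of one example to the steps of one $\pi\in\Pi$. Let $A\in\mathbb R^{n\times n}$ be lower triangular of full rank, and let $A=BC$ with $B\in\mathbb R^{n\times p}$, $C\in\mathbb R^{p\times n}$ be a factorization such that $\|C(x-\tilde x)\|_F\le\kappa$ for all $(x,\tilde x)\in\mathbf N$. Let $\sigma\in\mathbb R$, let $Z\in\mathbb R^{p\times d}$ have independent $\mathcal N(0,\kappa^2\sigma^2)$ entries, and let $\mathcal M(x)=Ax+BZ=B(Cx+Z)$. A privacy notion is one of the following relations between probability distributions $P,Q$: $(\varepsilon,\delta)$-DP with $\varepsilon,\delta\ge0$, that is, $P(S)\le e^{\varepsilon}Q(S)+\delta$ for all events $S$; $\rho$-zCDP with $\rho\ge0$, that is, $D_\alpha(P\|Q)\le\rho\alpha$ for all $\alpha>1$, where $D_\alpha$ is the Rényi divergence; $\mu$-Gaussian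 DP with $\mu\ge0$, that is, $T(P,Q)\ge T(\mathcal N(0,1),\mathcal N(\mu,1))$ on $[0,1]$, where $T(P,Q)(a)$ is the infimum of the type II errors of randomized tests of $P$ against $Q$ with type I error at most $a$. The mechanism satisfies a privacy notion in the nonadaptive continual release model if the laws of $\mathcal M(x)$ and $\mathcal M(\tilde x)$ are so related for all $(x,\tilde x)\in\mathbf N$. It satisfies it with adaptively chosen rows if the following holds for every adversary with private randomness $r$ (independent of $Z$): in each step $i$ the adversary chooses a pair of rows $(x_i,\tilde x_i)$ as a measurable function of $r$ and of the output rows released in steps $1,\dots,i-1$, such that $(x,\tilde x)\in\mathbf N$ for all values of $r$ and of the released rows; then the $i$-th row of $\mathcal M$ is released, where $\mathcal M$ receives $x_i$ in every step, or $\tilde x_i$ in every step; and the laws of $(r,\text{all released rows})$ in these two cases are so related. Then for each of the three privacy notions and for all values of its parameters: if $\mathcal M$ satisfies it in the nonadaptive continual release model, then $\mathcal M$ satisfies it, with the same parameters, when the rows of the input are chosen adaptively. -/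

import Mathlib

open MeasureTheory ProbabilityTheory
open scoped ENNReal NNReal

namespace ContinualRelease

noncomputable section

/-! ### Privacy notions for a pair of output distributions -/

/-- A way of saying that two probability distributions on a common measurable space are hard to
tell apart. A mechanism has the corresponding privacy guarantee when its output distributions on
all pairs of neighboring inputs are related in this way. -/
abbrev PrivacyNotion : Type 1 :=
  (Ω : Type) → [MeasurableSpace Ω] → Measure Ω → Measure Ω → Prop

/-- `(ε, δ)`-differential privacy: `P(S) ≤ e^ε Q(S) + δ` for all events `S`. -/
def approxDP (ε δ : ℝ≥0) : PrivacyNotion := fun _ _ P Q =>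
  ∀ S, MeasurableSet S → P S ≤ ENNReal.ofReal (Real.exp ε) * Q S + δ

open Classical in
/-- The Rényi divergence `D_α(P ‖ Q) = (α - 1)⁻¹ log ∫ (dP/dQ)^α dQ` of order `α > 1`, equal to
`∞` unless `P ≪ Q`. -/
def renyiDivergence {Ω : Type} [MeasurableSpace Ω] (α : ℝ) (P Q : Measure Ω) : EReal :=
  if P ≪ Q then (((α - 1)⁻¹ : ℝ) : EReal) * ENNReal.log (∫⁻ ω, (P.rnDeriv Q ω) ^ α ∂Q) else ⊤

/-- `ρ`-zero-concentrated differential privacy: `D_α(P ‖ Q) ≤ ρ α` for all `α > 1`. -/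
def zCDP (ρ : ℝ≥0) : PrivacyNotion := fun _ _ P Q =>
  ∀ α : ℝ, 1 < α → renyiDivergence α P Q ≤ ((ρ * α : ℝ) : EReal)

/-- The trade-off function `T(P, Q)`: the smallest type II error among (randomized) tests of
`P` against `Q` with type I error at most `a`. -/
def tradeoff {Ω : Type} [MeasurableSpace Ω] (P Q : Measure Ω) (a : ℝ) : ℝ :=
  sInf {b : ℝ | ∃ φ : Ω → ℝ, Measurable φ ∧ (∀ ω, φ ω ∈ Set.Icc (0 : ℝ) 1) ∧
    ∫ ω, φ ω ∂P ≤ a ∧ b = 1 - ∫ ω, φ ω ∂Q}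

/-- `μ`-Gaussian differential privacy: telling `P` from `Q` is at least as hard as telling
`N(0, 1)` from `N(μ, 1)`. -/
def gaussianDP (μ : ℝ≥0) : PrivacyNotion := fun _ _ P Q =>
  ∀ a ∈ Set.Icc (0 : ℝ) 1, tradeoff (gaussianReal 0 1) (gaussianReal μ 1) a ≤ tradeoff P Q a

/-! ### Streams and the Gaussian matrix mechanism -/

/-- A stream of `n` rows in `ℝ^d`. -/
abbrev DataStream (n d : ℕ) : Type := Matrix (Fin n) (Fin d) ℝ

/-- The product σ-algebra on matrices. -/
instance instMeasurableSpaceMatrix (m d : ℕ) : MeasurableSpace (Matrix (Fin m) (Fin d) ℝ) :=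
  inferInstanceAs (MeasurableSpace (Fin m → Fin d → ℝ))

open scoped Matrix.Norms.Frobenius in
/-- The Frobenius norm of a matrix. -/
def frobeniusNorm {m d : ℕ} (X : Matrix (Fin m) (Fin d) ℝ) : ℝ := ‖X‖

/-- The law of an `m × d` matrix with independent `N(0, v)` entries. -/
def gaussianMatrix (m d : ℕ) (v : ℝ≥0) : Measure (Matrix (Fin m) (Fin d) ℝ) :=
  (Measure.pi fun _ : Fin m => Measure.pi fun _ : Fin d => gaussianReal 0 v :
    Measure (Fin m → Fin d → ℝ))

/-- The output `B (C x + Z)` of the matrix mechanism on the stream `x` with noise `Z`. -/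
def matrixMechanism {n p d : ℕ} (B : Matrix (Fin n) (Fin p) ℝ) (C : Matrix (Fin p) (Fin n) ℝ)
    (Z : Matrix (Fin p) (Fin d) ℝ) (x : DataStream n d) : DataStream n d :=
  B * (C * x + Z)

/-! ### The nonadaptive and the adaptive continual release model

A mechanism is given by a noise space `W` with a distribution and a map `M` that sends a noise value
and an input stream to the output stream;
`N` is the set of pairs of neighboring streams, which may be any set of pairs: for instance those
that differ only in the contributions, bounded in norm, of one example to the steps of one
pattern of a participation schema. -/

/-- Nonadaptive model: the input stream is fixed in advance, and all rows of the output are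
released. -/
def NonadaptivelyPrivate (priv : PrivacyNotion) {n d : ℕ} (N : Set (DataStream n d × DataStream n d))
    {W : Type} [MeasurableSpace W] (noise : Measure W) (M : W → DataStream n d → DataStream n d) : Prop :=
  ∀ x x' : DataStream n d, (x, x') ∈ N →
    priv (DataStream n d) (noise.map fun z => M z x) (noise.map fun z => M z x')

/-- A rule for choosing the rows of a stream adaptively: the `i`-th row is a measurable function
of private randomness in `R` and of the output rows released before step `i`. -/
structure Strategy (n d : ℕ) (R : Type) [MeasurableSpace R] where
  /-- the row chosen at step `i` -/
  row : (i : Fin n) → R → ({j : Fin n // j < i} → Fin d → ℝ) → Fin d → ℝ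
  measurable_row : ∀ i, Measurable (Function.uncurry (row i))

/-- The stream that the rule chooses when the released rows are those of `y`. -/
def Strategy.stream {n d : ℕ} {R : Type} [MeasurableSpace R] (s : Strategy n d R) (r : R)
    (y : DataStream n d) : DataStream n d :=
  Matrix.of fun i => s.row i r fun j => y j

/-- The first `k` output rows of the interaction of the mechanism (with noise `z`) and the rule
`s` (with randomness `r`); the other rows are `0`. In step `k` the rule chooses the `k`-th input
row from the rows released so far, and the `k`-th output row of the mechanism on the stream so
far, with later input rows still `0`, is released. -/
def transcript {n d : ℕ} {R W : Type} [MeasurableSpace R] (M : W → DataStream n d → DataStream n d)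
    (s : Strategy n d R) (r : R) (z : W) : ℕ → DataStream n d
  | 0 => 0
  | k + 1 => Matrix.of fun i =>
      if (i : ℕ) = k then
        M z (Matrix.of fun j => if (j : ℕ) ≤ k then s.stream r (transcript M s r z k) j else 0) i
      else transcript M s r z k i

/-- What an adaptive adversary sees: the distribution of its own randomness together with all `n`
released rows, when the input rows are chosen by the rule `s`. -/
def viewLaw {n d : ℕ} {R W : Type} [MeasurableSpace R] [MeasurableSpace W] (seed : Measure R)
    (noise : Measure W) (M : W → DataStream n d → DataStream n d) (s : Strategy n d R) :
    Measure (R × DataStream n d) :=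
  (seed.prod noise).map fun q => (q.1, transcript M s q.1 q.2 n)

/-- Adaptive model: in each step an adversary, who may be randomized and sees all rows released
so far, chooses a pair of rows, given by rules `s` and `s'`, so that the resulting two streams are
neighboring whatever is released. The mechanism gets the row of `s` in every step, or that of
`s'` in every step, and these two cases have to be hard to tell apart for the adversary. -/
def AdaptivelyPrivate (priv : PrivacyNotion) {n d : ℕ} (N : Set (DataStream n d × DataStream n d))
    {W : Type} [MeasurableSpace W] (noise : Measure W) (M : W → DataStream n d → DataStream n d) : Prop :=
  ∀ (R : Type) [MeasurableSpace R] (seed : Measure R) [IsProbabilityMeasure seed]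
    (s s' : Strategy n d R), (∀ r y, (s.stream r y, s'.stream r y) ∈ N) →
    priv (R × DataStream n d) (viewLaw seed noise M s) (viewLaw seed noise M s')

end

end ContinualRelease

open ContinualRelease

/-!
Write `A = B C`. The output `A x + B Z` has the law of `L (V x + G)`, where `L` and `V` are lower
triangular with `A = L V` and `B Bᵀ = L Lᵀ`, and `G` is a Gaussian matrix. Since `L` and `V` are
causal, an adversary who sees `L (V x + G)` row by row faces a Gaussian mean `V x`, `V x'` whose
`i`-th row depends on the earlier rows only.

Such an adaptively chosen pair of means at distance at most `m` can be simulated from a single real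
number with law `N(0, v)` or `N(m, v)`: before each row, a reflection moves as much of the mean as
the row requires from that number to the row, and leaves a Gaussian number with the remaining mean.
So privacy of the pair `N(0, v)`, `N(m, v)` implies adaptive privacy, by postprocessing.

Projecting onto the direction of `V (x' - x)`, nonadaptive privacy yields privacy of this pair for
each `m` that is the norm of some `V (x' - x)`. It passes to the supremum of these norms, because
`N(m, v)` depends on `m` continuously for setwise convergence. If the norms are unbounded, or
`v = 0` and some norm is positive, then the pairs become perfectly distinguishable, and a privacy
notion that tolerates this relates any two distributions.
-/

namespace ContinualRelease

open Filter Topology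

lemma indicator_one_le_one {Ω : Type*} (S : Set Ω) (ω : Ω) :
    S.indicator (1 : Ω → ℝ≥0∞) ω ≤ (1 : ℝ≥0) := by
  by_cases hω : ω ∈ S <;> simp [hω]

section Distinguishability

variable {Ω : Type*} [MeasurableSpace Ω]

/-- Setwise convergence of a sequence of measures, expressed by the integrals of bounded measurable
functions. -/
def SetwiseTendsto (Qs : ℕ → Measure Ω) (Q : Measure Ω) : Prop :=
  ∀ (h : Ω → ℝ≥0∞) (c : ℝ≥0), Measurable h → (∀ ω, h ω ≤ c) →
    Tendsto (fun k => ∫⁻ ω, h ω ∂Qs k) atTop (𝓝 (∫⁻ ω, h ω ∂Q))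

/-- Asymptotic perfect distinguishability of `P` from the measures `Qs k`: some events have almost
full `P`-probability and almost no `Qs k`-probability. -/
def AsymptoticallySeparated (P : Measure Ω) (Qs : ℕ → Measure Ω) : Prop :=
  ∃ S : ℕ → Set Ω, (∀ k, MeasurableSet (S k)) ∧ Tendsto (fun k => P (S k)) atTop (𝓝 1) ∧
    Tendsto (fun k => Qs k (S k)) atTop (𝓝 0)

lemma SetwiseTendsto.measure {Qs : ℕ → Measure Ω} {Q : Measure Ω} (h : SetwiseTendsto Qs Q)
    {S : Set Ω} (hS : MeasurableSet S) : Tendsto (fun k => Qs k S) atTop (𝓝 (Q S)) := by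
  have hlim := h (S.indicator 1) 1 (measurable_one.indicator hS) (indicator_one_le_one S)
  simpa only [lintegral_indicator_one hS] using hlim

end Distinguishability

/-- A privacy notion is trivial if it relates any two probability distributions, as does for
instance `(ε, 1)`-differential privacy. -/
def PrivacyNotion.IsTrivial (priv : PrivacyNotion) : Prop :=
  ∀ (Ω : Type) [MeasurableSpace Ω] (P Q : Measure Ω) [IsProbabilityMeasure P]
    [IsProbabilityMeasure Q], priv Ω P Q

/-- The properties of a privacy notion on which the reduction from adaptively chosen to fixed
streams relies. Together `map` and `prod` say that the notion is stable under randomized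
postprocessing. -/
structure PrivacyNotion.IsStable (priv : PrivacyNotion) : Prop where
  refl : ∀ {Ω : Type} [MeasurableSpace Ω] (P : Measure Ω) [IsProbabilityMeasure P], priv Ω P P
  map : ∀ {Ω Ω' : Type} [MeasurableSpace Ω] [MeasurableSpace Ω'] {P Q : Measure Ω}
    [IsProbabilityMeasure P] [IsProbabilityMeasure Q] {f : Ω → Ω'}, Measurable f →
    priv Ω P Q → priv Ω' (P.map f) (Q.map f)
  prod : ∀ {Ω Ω' : Type} [MeasurableSpace Ω] [MeasurableSpace Ω'] {P Q : Measure Ω}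
    [IsProbabilityMeasure P] [IsProbabilityMeasure Q] (ν : Measure Ω') [IsProbabilityMeasure ν],
    priv Ω P Q → priv (Ω × Ω') (P.prod ν) (Q.prod ν)
  of_setwiseTendsto : ∀ {Ω : Type} [MeasurableSpace Ω] {P Q : Measure Ω} {Qs : ℕ → Measure Ω}
    [IsProbabilityMeasure P] [IsProbabilityMeasure Q] [∀ k, IsProbabilityMeasure (Qs k)],
    SetwiseTendsto Qs Q → (∀ k, priv Ω P (Qs k)) → priv Ω P Q
  isTrivial_of_separated : ∀ {Ω : Type} [MeasurableSpace Ω] {P : Measure Ω} {Qs : ℕ → Measure Ω}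
    [IsProbabilityMeasure P] [∀ k, IsProbabilityMeasure (Qs k)],
    AsymptoticallySeparated P Qs → (∀ k, priv Ω P (Qs k)) → priv.IsTrivial

section ApproxDP

lemma tendsto_exp_mul_add {ι : Type*} {l : Filter ι} {u : ι → ℝ≥0∞} {q : ℝ≥0∞}
    (hu : Tendsto u l (𝓝 q)) (ε δ : ℝ≥0) :
    Tendsto (fun k => ENNReal.ofReal (Real.exp ε) * u k + δ) l
      (𝓝 (ENNReal.ofReal (Real.exp ε) * q + δ)) :=
  (ENNReal.Tendsto.const_mul hu (Or.inr ENNReal.ofReal_ne_top)).add tendsto_const_nhds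

variable {Ω Ω' : Type} [MeasurableSpace Ω] [MeasurableSpace Ω'] {ε δ : ℝ≥0}

lemma approxDP_self (P : Measure Ω) : approxDP ε δ Ω P P := fun S _ => by
  have one_le_exp : (1 : ℝ≥0∞) ≤ ENNReal.ofReal (Real.exp ε) := by simp
  exact (le_mul_of_one_le_left' one_le_exp).trans le_self_add

lemma approxDP.prod {P Q : Measure Ω} [SFinite P] [SFinite Q] (h : approxDP ε δ Ω P Q)
    (ν : Measure Ω') [IsProbabilityMeasure ν] :
    approxDP ε δ (Ω × Ω') (P.prod ν) (Q.prod ν) := fun S hS => by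
  rw [Measure.prod_apply_symm hS, Measure.prod_apply_symm hS]
  calc ∫⁻ y, P ((fun x => (x, y)) ⁻¹' S) ∂ν
      ≤ ∫⁻ y, (ENNReal.ofReal (Real.exp ε) * Q ((fun x => (x, y)) ⁻¹' S) + δ) ∂ν :=
        lintegral_mono fun y => h _ (measurable_prodMk_right hS)
    _ = ENNReal.ofReal (Real.exp ε) * ∫⁻ y, Q ((fun x => (x, y)) ⁻¹' S) ∂ν + δ := by
        rw [lintegral_add_right _ measurable_const,
          lintegral_const_mul _ (measurable_measure_prodMk_right hS), lintegral_const,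
          measure_univ, mul_one]

lemma one_le_delta_of_separated {P : Measure Ω} {Qs : ℕ → Measure Ω}
    (hsep : AsymptoticallySeparated P Qs) (h : ∀ k, approxDP ε δ Ω P (Qs k)) :
    (1 : ℝ≥0∞) ≤ δ := by
  obtain ⟨S, hS, hP, hQ⟩ := hsep
  have hle := le_of_tendsto_of_tendsto' hP (tendsto_exp_mul_add hQ ε δ) fun k => h k _ (hS k)
  simpa using hle

theorem approxDP_isStable (ε δ : ℝ≥0) : (approxDP ε δ).IsStable where
  refl P _ := approxDP_self P
  map hf h S hS := by
    rw [Measure.map_apply hf hS, Measure.map_apply hf hS]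
    exact h _ (hf hS)
  prod ν _ h := approxDP.prod h ν
  of_setwiseTendsto hlim h S hS :=
    ge_of_tendsto' (tendsto_exp_mul_add (hlim.measure hS) ε δ) fun k => h k S hS
  isTrivial_of_separated hsep h _ _ _ _ _ _ _ _ :=
    (prob_le_one.trans (one_le_delta_of_separated hsep h)).trans le_add_self

end ApproxDP

section HolderBound

variable {Ω Ω' : Type*} [MeasurableSpace Ω] [MeasurableSpace Ω']

/-- The dual form of the bound `∫ (dP/dQ)^α dQ ≤ K^α`, where `α` is the conjugate exponent of `q`:
integration against `P` of bounded functions is bounded by `K` times the `L^q(Q)` norm. Unlike the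
bound on the density it passes directly to images, products and setwise limits. -/
def HolderBound (P Q : Measure Ω) (q : ℝ) (K : ℝ≥0∞) : Prop :=
  ∀ (h : Ω → ℝ≥0∞) (c : ℝ≥0), Measurable h → (∀ ω, h ω ≤ c) →
    ∫⁻ ω, h ω ∂P ≤ K * (∫⁻ ω, h ω ^ q ∂Q) ^ (1 / q)

namespace HolderBound

variable {P Q : Measure Ω} {α q : ℝ} {K : ℝ≥0∞}

lemma measure_le (h : HolderBound P Q q K) (hq : 0 < q) {S : Set Ω} (hS : MeasurableSet S) :
    P S ≤ K * Q S ^ (1 / q) := by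
  have indicator_rpow : (fun ω => S.indicator (1 : Ω → ℝ≥0∞) ω ^ q) = S.indicator 1 := by
    ext ω
    by_cases hω : ω ∈ S <;> simp [hω, hq]
  simpa only [indicator_rpow, lintegral_indicator_one hS] using
    h (S.indicator 1) 1 (measurable_one.indicator hS) (indicator_one_le_one S)

lemma absolutelyContinuous (h : HolderBound P Q q K) (hq : 0 < q) : P ≪ Q :=
  .mk fun S hS hQS => by
    simpa [hQS, ENNReal.zero_rpow_of_pos (inv_pos.2 hq)] using h.measure_le hq hS

lemma le_rpow_of_le_mul_rpow (hαq : α.HolderConjugate q) {J : ℝ≥0∞} (hJ : J ≠ ∞)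
    (h : J ≤ K * J ^ (1 / q)) : J ≤ K ^ α := by
  rcases eq_or_ne J 0 with rfl | hJ0
  · exact bot_le
  have split : J ^ (1 / α) * J ^ (1 / q) = J := by
    rw [← ENNReal.rpow_add _ _ hJ0 hJ, one_div, one_div, hαq.inv_add_inv_eq_one, ENNReal.rpow_one]
  have hle : J ^ (1 / α) ≤ K := by
    rw [← ENNReal.mul_le_mul_iff_left (c := J ^ (1 / q)) (by simp [hJ0, hJ])
      (by simp [ENNReal.rpow_eq_top_iff, hJ0, hJ]), split]
    exact h
  exact (ENNReal.rpow_inv_le_iff hαq.pos).1 (one_div α ▸ hle)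

/-- The bound is applied to the extremal function `p^(α - 1)` of Hölder's inequality, where `p` is
the density; the truncation at `k` makes it bounded. -/
lemma lintegral_min_rnDeriv_rpow_le [SigmaFinite P] [IsFiniteMeasure Q] (h : HolderBound P Q q K)
    (hαq : α.HolderConjugate q) (k : ℕ) :
    ∫⁻ ω, min (P.rnDeriv Q ω) k ^ α ∂Q ≤ K ^ α := by
  have hα : 0 ≤ α - 1 := hαq.sub_one_pos.le
  set p : Ω → ℝ≥0∞ := fun ω => min (P.rnDeriv Q ω) k
  have hp : Measurable p := (Measure.measurable_rnDeriv P Q).min measurable_const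
  refine le_rpow_of_le_mul_rpow hαq ?_ ?_
  · refine ne_top_of_le_ne_top (b := (k : ℝ≥0∞) ^ α * Q Set.univ)
      (ENNReal.mul_ne_top (by simp [hαq.pos.le]) (measure_ne_top Q _)) ?_
    rw [← lintegral_const]
    exact lintegral_mono fun ω => ENNReal.rpow_le_rpow (min_le_right _ _) hαq.pos.le
  calc ∫⁻ ω, p ω ^ α ∂Q
      ≤ ∫⁻ ω, P.rnDeriv Q ω * p ω ^ (α - 1) ∂Q := lintegral_mono fun ω => by
        calc p ω ^ α = p ω ^ (1 + (α - 1)) := by rw [add_sub_cancel]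
          _ = p ω * p ω ^ (α - 1) := by
            rw [ENNReal.rpow_add_of_nonneg _ _ zero_le_one hα, ENNReal.rpow_one]
          _ ≤ P.rnDeriv Q ω * p ω ^ (α - 1) := by gcongr; exact min_le_left _ _
    _ = ∫⁻ ω, p ω ^ (α - 1) ∂P :=
        lintegral_rnDeriv_mul (h.absolutelyContinuous hαq.symm.pos) (hp.pow_const _).aemeasurable
    _ ≤ K * (∫⁻ ω, (p ω ^ (α - 1)) ^ q ∂Q) ^ (1 / q) :=
        h _ ((k : ℝ≥0) ^ (α - 1)) (hp.pow_const _) fun ω => by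
          rw [ENNReal.coe_rpow_of_nonneg _ hα]
          exact ENNReal.rpow_le_rpow (by simp [p]) hα
    _ = K * (∫⁻ ω, p ω ^ α ∂Q) ^ (1 / q) := by
        simp only [← ENNReal.rpow_mul, hαq.sub_one_mul_conj]

lemma lintegral_rnDeriv_rpow_le [SigmaFinite P] [IsFiniteMeasure Q] (h : HolderBound P Q q K)
    (hαq : α.HolderConjugate q) : ∫⁻ ω, P.rnDeriv Q ω ^ α ∂Q ≤ K ^ α := by
  refine le_of_tendsto' (lintegral_tendsto_of_tendsto_of_monotone (fun k => ?_)
    (ae_of_all _ fun ω k l hkl => ?_) (ae_of_all _ fun ω => ?_))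
    (h.lintegral_min_rnDeriv_rpow_le hαq)
  · exact (((Measure.measurable_rnDeriv P Q).min measurable_const).pow_const _).aemeasurable
  · exact ENNReal.rpow_le_rpow (min_le_min_left _ (Nat.cast_le.2 hkl)) hαq.pos.le
  · refine (ENNReal.continuous_rpow_const.tendsto _).comp ?_
    simpa using (tendsto_const_nhds (x := P.rnDeriv Q ω)).min ENNReal.tendsto_nat_nhds_top

lemma iff_lintegral_rnDeriv_rpow_le [SigmaFinite P] [IsFiniteMeasure Q]
    (hαq : α.HolderConjugate q) :
    HolderBound P Q q K ↔ P ≪ Q ∧ ∫⁻ ω, P.rnDeriv Q ω ^ α ∂Q ≤ K ^ α := by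
  refine ⟨fun h => ⟨h.absolutelyContinuous hαq.symm.pos, h.lintegral_rnDeriv_rpow_le hαq⟩, ?_⟩
  rintro ⟨hPQ, hI⟩ h c hh -
  calc ∫⁻ ω, h ω ∂P = ∫⁻ ω, P.rnDeriv Q ω * h ω ∂Q :=
        (lintegral_rnDeriv_mul hPQ hh.aemeasurable).symm
    _ ≤ (∫⁻ ω, P.rnDeriv Q ω ^ α ∂Q) ^ (1 / α) * (∫⁻ ω, h ω ^ q ∂Q) ^ (1 / q) :=
        ENNReal.lintegral_mul_le_Lp_mul_Lq Q hαq (Measure.measurable_rnDeriv P Q).aemeasurable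
          hh.aemeasurable
    _ ≤ K * (∫⁻ ω, h ω ^ q ∂Q) ^ (1 / q) := by
        gcongr
        rw [one_div]
        exact (ENNReal.rpow_inv_le_iff hαq.pos).2 hI

lemma map (h : HolderBound P Q q K) {f : Ω → Ω'} (hf : Measurable f) :
    HolderBound (P.map f) (Q.map f) q K := fun g c hg hc => by
  rw [lintegral_map hg hf, lintegral_map (hg.pow_const _) hf]
  exact h (g ∘ f) c (hg.comp hf) fun ω => hc _

lemma lintegral_rpow_one_div_le (ν : Measure Ω) [IsProbabilityMeasure ν]
    (hαq : α.HolderConjugate q) {f : Ω → ℝ≥0∞} (hf : Measurable f) :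
    ∫⁻ ω, f ω ^ (1 / q) ∂ν ≤ (∫⁻ ω, f ω ∂ν) ^ (1 / q) := by
  have holder := ENNReal.lintegral_mul_le_Lp_mul_Lq ν hαq (f := 1) (g := fun ω => f ω ^ (1 / q))
    aemeasurable_const (hf.pow_const _).aemeasurable
  simpa [← ENNReal.rpow_mul, hαq.symm.ne_zero] using holder

lemma prod [SFinite P] [SFinite Q] (h : HolderBound P Q q K) (hαq : α.HolderConjugate q)
    (ν : Measure Ω') [IsProbabilityMeasure ν] :
    HolderBound (P.prod ν) (Q.prod ν) q K := fun g c hg hc => by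
  have hgq : Measurable fun z => g z ^ q := hg.pow_const _
  rw [lintegral_prod_symm _ hg.aemeasurable, lintegral_prod_symm _ hgq.aemeasurable]
  calc ∫⁻ y, ∫⁻ x, g (x, y) ∂P ∂ν
      ≤ ∫⁻ y, K * (∫⁻ x, g (x, y) ^ q ∂Q) ^ (1 / q) ∂ν :=
        lintegral_mono fun y => h (fun x => g (x, y)) c (hg.comp measurable_prodMk_right)
          fun _ => hc _
    _ = K * ∫⁻ y, (∫⁻ x, g (x, y) ^ q ∂Q) ^ (1 / q) ∂ν :=
        lintegral_const_mul _ (hgq.lintegral_prod_left'.pow_const _)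
    _ ≤ K * (∫⁻ y, ∫⁻ x, g (x, y) ^ q ∂Q ∂ν) ^ (1 / q) := by
        gcongr
        exact lintegral_rpow_one_div_le ν hαq hgq.lintegral_prod_left'

lemma of_setwiseTendsto {Qs : ℕ → Measure Ω} (hlim : SetwiseTendsto Qs Q) (hq : 0 ≤ q)
    (hK : K ≠ ∞) (h : ∀ k, HolderBound P (Qs k) q K) : HolderBound P Q q K := fun g c hg hc => by
  have tendsto_lintegral_rpow := hlim (fun ω => g ω ^ q) (c ^ q) (hg.pow_const _) fun ω => by
    rw [ENNReal.coe_rpow_of_nonneg _ hq]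
    exact ENNReal.rpow_le_rpow (hc ω) hq
  exact ge_of_tendsto' (ENNReal.Tendsto.const_mul ((ENNReal.continuous_rpow_const.tendsto _).comp
    tendsto_lintegral_rpow) (Or.inr hK)) fun k => h k g c hg hc

lemma not_separated {Qs : ℕ → Measure Ω} (hq : 0 < q) (hK : K ≠ ∞)
    (h : ∀ k, HolderBound P (Qs k) q K) : ¬ AsymptoticallySeparated P Qs := by
  rintro ⟨S, hS, hP, hQ⟩
  have hlim := ENNReal.Tendsto.const_mul
    ((ENNReal.continuous_rpow_const (y := 1 / q)).tendsto _ |>.comp hQ) (Or.inr hK)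
  have hle := le_of_tendsto_of_tendsto' hP hlim fun k => (h k).measure_le hq (hS k)
  simp [ENNReal.zero_rpow_of_pos (inv_pos.2 hq)] at hle

end HolderBound

end HolderBound

section ZCDP

lemma inv_mul_le_coe_iff {c b : ℝ} (hc : 0 < c) (x : EReal) :
    (c⁻¹ : ℝ) * x ≤ (b : EReal) ↔ x ≤ ((b * c : ℝ) : EReal) := by
  induction x with
  | bot => simp [EReal.coe_mul_bot_of_pos (inv_pos.2 hc)]
  | top => simp [EReal.coe_mul_top_of_pos (inv_pos.2 hc), -EReal.coe_mul]
  | coe x =>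
    rw [← EReal.coe_mul, EReal.coe_le_coe_iff, EReal.coe_le_coe_iff, inv_mul_le_iff₀ hc, mul_comm]

lemma log_le_coe_iff (x : ℝ≥0∞) (b : ℝ) :
    ENNReal.log x ≤ (b : EReal) ↔ x ≤ ENNReal.ofReal (Real.exp b) := by
  rw [← ENNReal.log_le_log_iff, ENNReal.log_ofReal_of_pos (Real.exp_pos b), Real.log_exp]

variable {Ω : Type} [MeasurableSpace Ω] {ρ : ℝ≥0}

lemma renyiDivergence_le_iff {P Q : Measure Ω} {α : ℝ} (hα : 1 < α) :
    renyiDivergence α P Q ≤ ((ρ * α : ℝ) : EReal) ↔ P ≪ Q ∧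
      ∫⁻ ω, (P.rnDeriv Q ω) ^ α ∂Q ≤ ENNReal.ofReal (Real.exp (ρ * (α - 1))) ^ α := by
  unfold renyiDivergence
  split_ifs with h
  · rw [inv_mul_le_coe_iff (sub_pos.2 hα), log_le_coe_iff,
      ENNReal.ofReal_rpow_of_pos (Real.exp_pos _), ← Real.exp_mul]
    simp only [h, true_and]
    ring_nf
  · simp [h, -EReal.coe_mul]

lemma zCDP_iff_holderBound {P Q : Measure Ω} [SigmaFinite P] [IsFiniteMeasure Q] :
    zCDP ρ Ω P Q ↔ ∀ α q : ℝ, α.HolderConjugate q →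
      HolderBound P Q q (ENNReal.ofReal (Real.exp (ρ * (α - 1)))) := by
  refine ⟨fun h α q hαq => ?_, fun h α hα => ?_⟩
  · exact (HolderBound.iff_lintegral_rnDeriv_rpow_le hαq).2
      ((renyiDivergence_le_iff hαq.lt).1 (h α hαq.lt))
  · have hαq := Real.HolderConjugate.conjExponent hα
    exact (renyiDivergence_le_iff hα).2
      ((HolderBound.iff_lintegral_rnDeriv_rpow_le hαq).1 (h α _ hαq))

lemma zCDP_self (P : Measure Ω) [IsProbabilityMeasure P] : zCDP ρ Ω P P := fun α hα => by
  refine (renyiDivergence_le_iff hα).2 ⟨.rfl, ?_⟩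
  have rnDeriv_rpow : (fun ω => P.rnDeriv P ω ^ α) =ᵐ[P] fun _ => 1 := by
    filter_upwards [Measure.rnDeriv_self P] with ω hω
    rw [hω, ENNReal.one_rpow]
  rw [lintegral_congr_ae rnDeriv_rpow, lintegral_one, measure_univ]
  refine ENNReal.one_le_rpow ?_ (zero_lt_one.trans hα)
  simpa using ENNReal.ofReal_le_ofReal (Real.one_le_exp (mul_nonneg ρ.2 (sub_pos.2 hα).le))

theorem zCDP_isStable (ρ : ℝ≥0) : (zCDP ρ).IsStable where
  refl P _ := zCDP_self P
  map {_ _ _ _ P Q _ _ _} hf h := by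
    have := Measure.isProbabilityMeasure_map (μ := P) hf.aemeasurable
    have := Measure.isProbabilityMeasure_map (μ := Q) hf.aemeasurable
    exact zCDP_iff_holderBound.2 fun α q hαq => (zCDP_iff_holderBound.1 h α q hαq).map hf
  prod ν _ h :=
    zCDP_iff_holderBound.2 fun α q hαq => (zCDP_iff_holderBound.1 h α q hαq).prod hαq ν
  of_setwiseTendsto hlim h := zCDP_iff_holderBound.2 fun α q hαq =>
    .of_setwiseTendsto hlim hαq.symm.nonneg ENNReal.ofReal_ne_top
      fun k => zCDP_iff_holderBound.1 (h k) α q hαq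
  isTrivial_of_separated hsep h := absurd hsep <|
    HolderBound.not_separated two_pos ENNReal.ofReal_ne_top
      fun k => zCDP_iff_holderBound.1 (h k) 2 2 Real.HolderConjugate.two_two

end ZCDP

section GaussianDP

section Tests

variable {Ω : Type*} [MeasurableSpace Ω] {φ : Ω → ℝ}

lemma integrable_of_mem_Icc (Q : Measure Ω) [IsFiniteMeasure Q] (hm : Measurable φ)
    (hφ : ∀ ω, φ ω ∈ Set.Icc (0 : ℝ) 1) : Integrable φ Q :=
  .of_bound hm.aestronglyMeasurable 1 <| ae_of_all _ fun ω =>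
    (Real.norm_of_nonneg (hφ ω).1).trans_le (hφ ω).2

lemma integral_mem_Icc (Q : Measure Ω) [IsProbabilityMeasure Q]
    (hφ : ∀ ω, φ ω ∈ Set.Icc (0 : ℝ) 1) : ∫ ω, φ ω ∂Q ∈ Set.Icc (0 : ℝ) 1 := by
  refine ⟨integral_nonneg fun ω => (hφ ω).1, ?_⟩
  simpa using integral_mono_of_nonneg (μ := Q) (ae_of_all _ fun ω => (hφ ω).1)
    (integrable_const (1 : ℝ)) (ae_of_all _ fun ω => (hφ ω).2)

lemma SetwiseTendsto.integral {Qs : ℕ → Measure Ω} {Q : Measure Ω} [IsFiniteMeasure Q]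
    (h : SetwiseTendsto Qs Q) (hm : Measurable φ) (hφ : ∀ ω, φ ω ∈ Set.Icc (0 : ℝ) 1) :
    Tendsto (fun k => ∫ ω, φ ω ∂Qs k) atTop (𝓝 (∫ ω, φ ω ∂Q)) := by
  simp only [integral_eq_lintegral_of_nonneg_ae (ae_of_all _ fun ω => (hφ ω).1)
    hm.aestronglyMeasurable]
  refine (ENNReal.tendsto_toReal ?_).comp
    (h (fun ω => ENNReal.ofReal (φ ω)) 1 hm.ennreal_ofReal fun ω => by simpa using (hφ ω).2)
  exact (integrable_of_mem_Icc Q hm hφ).lintegral_lt_top.ne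

lemma exists_forall_measureReal_lt_of_absolutelyContinuous {P Q : Measure Ω} [IsFiniteMeasure P]
    [IsFiniteMeasure Q] (hQP : Q ≪ P) {ε : ℝ} (hε : 0 < ε) :
    ∃ δ > 0, ∀ S, P.real S < δ → Q.real S < ε := by
  obtain ⟨δ, hδ, h⟩ := exists_pos_setLIntegral_lt_of_measure_lt (μ := P) (f := Q.rnDeriv P)
    (Measure.lintegral_rnDeriv_lt_top Q P).ne (ENNReal.ofReal_pos.2 hε).ne'
  refine ⟨(min δ 1).toReal, ENNReal.toReal_pos (by simp [hδ.ne']) (by simp), fun S hS => ?_⟩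
  have hPS : P S < δ :=
    ((ENNReal.toReal_lt_toReal (measure_ne_top P S) (by simp)).1 hS).trans_le (min_le_left _ _)
  rw [measureReal_def, ← ENNReal.lt_ofReal_iff_toReal_lt (measure_ne_top Q S),
    ← Measure.setLIntegral_rnDeriv hQP]
  exact h S hPS

end Tests

variable {Ω Ω' : Type} [MeasurableSpace Ω] [MeasurableSpace Ω'] {P Q : Measure Ω} {a : ℝ}

lemma tradeoff_le [IsProbabilityMeasure Q] {φ : Ω → ℝ} (hm : Measurable φ)
    (hφ : ∀ ω, φ ω ∈ Set.Icc (0 : ℝ) 1) (ha : ∫ ω, φ ω ∂P ≤ a) :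
    tradeoff P Q a ≤ 1 - ∫ ω, φ ω ∂Q := by
  refine csInf_le ⟨0, ?_⟩ ⟨φ, hm, hφ, ha, rfl⟩
  rintro b ⟨ψ, -, hψ, -, rfl⟩
  exact sub_nonneg.2 (integral_mem_Icc Q hψ).2

lemma le_tradeoff_iff [IsProbabilityMeasure Q] {t : ℝ} (ha : 0 ≤ a) :
    t ≤ tradeoff P Q a ↔
      ∀ φ : Ω → ℝ, Measurable φ → (∀ ω, φ ω ∈ Set.Icc (0 : ℝ) 1) → ∫ ω, φ ω ∂P ≤ a →
        t ≤ 1 - ∫ ω, φ ω ∂Q := by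
  refine ⟨fun h φ hm hφ hφa => h.trans (tradeoff_le hm hφ hφa), fun h => ?_⟩
  refine le_csInf ⟨1, 0, measurable_zero, by simp, by simpa using ha, by simp⟩ ?_
  rintro b ⟨ψ, hm, hψ, hψa, rfl⟩
  exact h ψ hm hψ hψa

lemma tradeoff_le_one_sub [IsProbabilityMeasure P] [IsProbabilityMeasure Q]
    (ha : a ∈ Set.Icc (0 : ℝ) 1) : tradeoff P Q a ≤ 1 - a := by
  simpa using tradeoff_le (P := P) (Q := Q) (φ := fun _ => a) measurable_const (fun _ => ha)
    (by simp)

lemma tradeoff_le_measureReal [IsProbabilityMeasure Q] {S : Set Ω} (hS : MeasurableSet S)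
    (ha : P.real Sᶜ ≤ a) : tradeoff P Q a ≤ Q.real S := by
  have h := tradeoff_le (P := P) (Q := Q) (a := a) (φ := Sᶜ.indicator 1)
    (measurable_one.indicator hS.compl)
    (fun ω => by by_cases hω : ω ∈ S <;> simp [hω]) (by rwa [integral_indicator_one hS.compl])
  rwa [integral_indicator_one hS.compl, probReal_compl_eq_one_sub hS, sub_sub_cancel] at h

/-- If the type I error is small then so is the `P`-probability of `{1/2 ≤ φ}`, hence also its
`Q`-probability. -/
lemma exists_tradeoff_pos [IsProbabilityMeasure P] [IsProbabilityMeasure Q] (hQP : Q ≪ P) :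
    ∃ a ∈ Set.Ioc (0 : ℝ) 1, 0 < tradeoff P Q a := by
  obtain ⟨δ, hδ, hPQ⟩ := exists_forall_measureReal_lt_of_absolutelyContinuous hQP
    (by norm_num : (0 : ℝ) < 1 / 4)
  refine ⟨min (δ / 4) 1, ⟨by positivity, min_le_right _ _⟩,
    (by norm_num : (0 : ℝ) < 1 / 4).trans_le ((le_tradeoff_iff (by positivity)).2 ?_)⟩
  intro φ hm hφ hφa
  set S := {ω | 1 / 2 ≤ φ ω}
  have hS : MeasurableSet S := measurableSet_le measurable_const hm
  have markov : 1 / 2 * P.real S ≤ ∫ ω, φ ω ∂P :=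
    mul_meas_ge_le_integral_of_nonneg (ae_of_all _ fun ω => (hφ ω).1)
      (integrable_of_mem_Icc P hm hφ) _
  have hQS : Q.real S < 1 / 4 := hPQ S (by linarith [min_le_left (δ / 4) 1])
  have hφS : ∫ ω, φ ω ∂Q ≤ Q.real S + 1 / 2 := by
    have hint : Integrable (S.indicator (1 : Ω → ℝ)) Q := (integrable_const (1 : ℝ)).indicator hS
    calc ∫ ω, φ ω ∂Q ≤ ∫ ω, (S.indicator 1 ω + 1 / 2) ∂Q := by
          refine integral_mono (integrable_of_mem_Icc Q hm hφ)
            (hint.add (integrable_const _)) fun ω => ?_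
          by_cases hω : ω ∈ S
          · simpa only [Set.indicator_of_mem hω] using (hφ ω).2.trans (by norm_num)
          · simpa only [Set.indicator_of_notMem hω, zero_add] using (not_le.1 hω).le
      _ = Q.real S + 1 / 2 := by
          rw [integral_add hint (integrable_const _), integral_indicator_one hS, integral_const,
            probReal_univ, one_smul]
  linarith

lemma tradeoff_gaussianReal_pos (μ : ℝ) :
    ∃ a ∈ Set.Ioc (0 : ℝ) 1, 0 < tradeoff (gaussianReal 0 1) (gaussianReal μ 1) a :=
  exists_tradeoff_pos <| (gaussianReal_absolutelyContinuous μ one_ne_zero).trans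
    (gaussianReal_absolutelyContinuous' 0 one_ne_zero)

variable {μ : ℝ≥0}

lemma gaussianDP_iff [IsProbabilityMeasure Q] : gaussianDP μ Ω P Q ↔
    ∀ a ∈ Set.Icc (0 : ℝ) 1, ∀ φ : Ω → ℝ, Measurable φ → (∀ ω, φ ω ∈ Set.Icc (0 : ℝ) 1) →
      ∫ ω, φ ω ∂P ≤ a → tradeoff (gaussianReal 0 1) (gaussianReal μ 1) a ≤ 1 - ∫ ω, φ ω ∂Q :=
  forall₂_congr fun _ ha => le_tradeoff_iff ha.1

lemma gaussianDP_self [IsProbabilityMeasure P] : gaussianDP μ Ω P P :=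
  gaussianDP_iff.2 fun _ ha _ _ _ hφa => (tradeoff_le_one_sub ha).trans (sub_le_sub_left hφa 1)

lemma gaussianDP.map [IsProbabilityMeasure Q] (h : gaussianDP μ Ω P Q) {f : Ω → Ω'}
    (hf : Measurable f) : gaussianDP μ Ω' (P.map f) (Q.map f) := by
  have := Measure.isProbabilityMeasure_map (μ := Q) hf.aemeasurable
  refine gaussianDP_iff.2 fun a ha φ hm hφ hφa => ?_
  rw [integral_map hf.aemeasurable hm.aestronglyMeasurable] at hφa ⊢
  exact gaussianDP_iff.1 h a ha _ (hm.comp hf) (fun ω => hφ _) hφa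

lemma gaussianDP.prod [IsProbabilityMeasure P] [IsProbabilityMeasure Q] (h : gaussianDP μ Ω P Q)
    (ν : Measure Ω') [IsProbabilityMeasure ν] :
    gaussianDP μ (Ω × Ω') (P.prod ν) (Q.prod ν) := by
  refine gaussianDP_iff.2 fun a ha φ hm hφ hφa => ?_
  rw [integral_prod _ (integrable_of_mem_Icc _ hm hφ)] at hφa ⊢
  exact gaussianDP_iff.1 h a ha (fun x => ∫ y, φ (x, y) ∂ν)
    hm.stronglyMeasurable.integral_prod_right'.measurable
    (fun x => integral_mem_Icc ν fun y => hφ _) hφa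

lemma gaussianDP.not_separated [IsProbabilityMeasure P] {Qs : ℕ → Measure Ω}
    [∀ k, IsProbabilityMeasure (Qs k)] (h : ∀ k, gaussianDP μ Ω P (Qs k)) :
    ¬ AsymptoticallySeparated P Qs := by
  rintro ⟨S, hS, hP, hQ⟩
  obtain ⟨a, ha, hpos⟩ := tradeoff_gaussianReal_pos μ
  have hQ' : Tendsto (fun k => (Qs k).real (S k)) atTop (𝓝 0) :=
    (ENNReal.tendsto_toReal ENNReal.zero_ne_top).comp hQ
  have hPc : Tendsto (fun k => P.real (S k)ᶜ) atTop (𝓝 0) := by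
    have hP' := (ENNReal.tendsto_toReal ENNReal.one_ne_top).comp hP
    simpa [probReal_compl_eq_one_sub (hS _), measureReal_def] using hP'.const_sub 1
  refine hpos.not_ge (ge_of_tendsto hQ' ?_)
  filter_upwards [hPc.eventually_le_const ha.1] with k hk
  exact (h k a (Set.Ioc_subset_Icc_self ha)).trans (tradeoff_le_measureReal (hS k) hk)

theorem gaussianDP_isStable (μ : ℝ≥0) : (gaussianDP μ).IsStable where
  refl _ _ := gaussianDP_self
  map hf h := gaussianDP.map h hf
  prod ν _ h := gaussianDP.prod h ν
  of_setwiseTendsto hlim h := gaussianDP_iff.2 fun a ha φ hm hφ hφa =>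
    ge_of_tendsto' ((hlim.integral hm hφ).const_sub 1)
      fun k => gaussianDP_iff.1 (h k) a ha φ hm hφ hφa
  isTrivial_of_separated hsep h := absurd hsep (gaussianDP.not_separated h)

end GaussianDP

section OneDimensionalGaussians

variable {v : ℝ≥0}

/-- With `u = x - m'` and `|m' - m| ≤ 1` one has `(x - m)² ≤ 2 u² + 2`. -/
lemma gaussianPDFReal_le_of_abs_sub_le_one {m m' : ℝ} (h : |m' - m| ≤ 1) (x : ℝ) :
    gaussianPDFReal m' v x ≤ √2 * Real.exp (1 / (2 * v)) * gaussianPDFReal m (2 * v) x := by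
  have exponent_le : -(x - m') ^ 2 / (2 * v) ≤ 1 / (2 * v) + -(x - m) ^ 2 / (2 * (2 * v)) := by
    have dist_sq_le : (m' - m) ^ 2 ≤ 1 := (sq_le_one_iff_abs_le_one _).2 h
    rw [← div_div (-(x - m) ^ 2) 2, ← add_div]
    refine div_le_div_of_nonneg_right ?_ (by positivity)
    nlinarith [sq_nonneg (x - m' - (m' - m))]
  have sqrt_eq : √(2 * Real.pi * (2 * v)) = √2 * √(2 * Real.pi * v) := by
    rw [← Real.sqrt_mul zero_le_two]
    ring_nf
  calc gaussianPDFReal m' v x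
      ≤ (√(2 * Real.pi * v))⁻¹ * Real.exp (1 / (2 * v) + -(x - m) ^ 2 / (2 * (2 * v))) := by
        unfold gaussianPDFReal
        gcongr
    _ = √2 * Real.exp (1 / (2 * v)) * gaussianPDFReal m (2 * v) x := by
        unfold gaussianPDFReal
        push_cast
        rw [sqrt_eq, Real.exp_add, mul_inv]
        field_simp

lemma setwiseTendsto_gaussianReal (hv : v ≠ 0) {ms : ℕ → ℝ} {m : ℝ}
    (hm : Tendsto ms atTop (𝓝 m)) :
    SetwiseTendsto (fun k => gaussianReal (ms k) v) (gaussianReal m v) := by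
  intro h c hh hc
  simp only [gaussianReal_of_var_ne_zero _ hv,
    lintegral_withDensity_eq_lintegral_mul _ (measurable_gaussianPDF _ _) hh, Pi.mul_apply]
  set K := √2 * Real.exp (1 / (2 * v))
  refine tendsto_lintegral_filter_of_dominated_convergence
    (fun x => ENNReal.ofReal K * gaussianPDF m (2 * v) x * c)
    (.of_forall fun k => (measurable_gaussianPDF _ _).mul hh) ?_ ?_ (ae_of_all _ fun x => ?_)
  · filter_upwards [Metric.tendsto_nhds.1 hm 1 one_pos] with k hk
    refine ae_of_all _ fun x => mul_le_mul' ?_ (hc x)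
    rw [gaussianPDF, gaussianPDF, ← ENNReal.ofReal_mul (by positivity)]
    exact ENNReal.ofReal_le_ofReal (gaussianPDFReal_le_of_abs_sub_le_one hk.le x)
  · rw [lintegral_mul_const _ ((measurable_gaussianPDF _ _).const_mul _),
      lintegral_const_mul _ (measurable_gaussianPDF _ _),
      lintegral_gaussianPDF_eq_one _ (mul_ne_zero two_ne_zero hv)]
    simp [ENNReal.mul_eq_top]
  · refine ENNReal.Tendsto.mul_const ?_ (Or.inr (ne_top_of_le_ne_top ENNReal.coe_ne_top (hc x)))
    have continuous_mean : Continuous fun m => gaussianPDFReal m v x := by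
      unfold gaussianPDFReal
      fun_prop
    exact (ENNReal.continuous_ofReal.tendsto _).comp ((continuous_mean.tendsto m).comp hm)

lemma asymptoticallySeparated_map_add (P : Measure ℝ) [IsProbabilityMeasure P] {ms : ℕ → ℝ}
    (hms : Tendsto ms atTop atTop) :
    AsymptoticallySeparated P fun k => P.map (· + ms k) := by
  have hhalf : Tendsto (fun k => ms k / 2) atTop atTop := hms.atTop_div_const two_pos
  refine ⟨fun k => Set.Iic (ms k / 2), fun k => measurableSet_Iic, ?_, ?_⟩
  · simpa only [ofReal_cdf, ENNReal.ofReal_one, Function.comp_def] using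
      ENNReal.tendsto_ofReal ((tendsto_cdf_atTop P).comp hhalf)
  · have map_apply : ∀ k, P.map (· + ms k) (Set.Iic (ms k / 2)) = P (Set.Iic (-(ms k / 2))) := by
      intro k
      rw [Measure.map_apply (measurable_add_const _) measurableSet_Iic, Set.preimage_add_const_Iic]
      congr 2
      ring
    simpa only [map_apply, ofReal_cdf, ENNReal.ofReal_zero, Function.comp_def] using
      ENNReal.tendsto_ofReal
        ((tendsto_cdf_atBot P).comp (tendsto_neg_atTop_atBot.comp hhalf))

lemma asymptoticallySeparated_dirac {Ω : Type*} [MeasurableSpace Ω] [MeasurableSingletonClass Ω]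
    {a b : Ω} (hab : a ≠ b) :
    AsymptoticallySeparated (Measure.dirac a) fun _ => Measure.dirac b :=
  ⟨fun _ => {a}, fun _ => measurableSet_singleton a, by simp, by simp [hab.symm]⟩

namespace PrivacyNotion.IsStable

variable {priv : PrivacyNotion} {S : Set ℝ}

lemma isTrivial_of_not_bddAbove (hpriv : priv.IsStable)
    (h : ∀ m ∈ S, priv ℝ (gaussianReal 0 v) (gaussianReal m v)) (hS : ¬ BddAbove S) :
    priv.IsTrivial := by
  choose ms hmS hlt using fun k : ℕ => not_bddAbove_iff.1 hS k
  have hms : Tendsto ms atTop atTop :=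
    tendsto_atTop_mono (fun k => (hlt k).le) tendsto_natCast_atTop_atTop
  have hsep := asymptoticallySeparated_map_add (gaussianReal 0 v) hms
  simp only [gaussianReal_map_add_const, zero_add] at hsep
  exact hpriv.isTrivial_of_separated hsep fun k => h _ (hmS k)

lemma isTrivial_of_ne_zero (hpriv : priv.IsStable) {m : ℝ} (hm : m ≠ 0)
    (h : priv ℝ (gaussianReal 0 0) (gaussianReal m 0)) : priv.IsTrivial := by
  simp only [gaussianReal_zero_var] at h
  exact hpriv.isTrivial_of_separated (asymptoticallySeparated_dirac hm.symm) fun _ => h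

theorem isTrivial_or_gaussianReal_sSup (hpriv : priv.IsStable) (hne : S.Nonempty)
    (h : ∀ m ∈ S, priv ℝ (gaussianReal 0 v) (gaussianReal m v)) :
    priv.IsTrivial ∨ BddAbove S ∧ priv ℝ (gaussianReal 0 v) (gaussianReal (sSup S) v) := by
  by_cases hS : BddAbove S
  swap
  · exact .inl (hpriv.isTrivial_of_not_bddAbove h hS)
  obtain rfl | hv := eq_or_ne v 0
  · by_cases h0 : ∀ m ∈ S, m = 0
    · have sSup_eq : sSup S = 0 := by
        rw [Set.eq_singleton_iff_nonempty_unique_mem.2 ⟨hne, h0⟩, csSup_singleton]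
      exact .inr ⟨hS, sSup_eq ▸ hpriv.refl _⟩
    · push Not at h0
      obtain ⟨m, hmS, hm⟩ := h0
      exact .inl (hpriv.isTrivial_of_ne_zero hm (h m hmS))
  · obtain ⟨ms, -, hms, hmS⟩ := exists_seq_tendsto_sSup hne hS
    exact .inr ⟨hS, hpriv.of_setwiseTendsto (setwiseTendsto_gaussianReal hv hms)
      fun k => h _ (hmS k)⟩

end PrivacyNotion.IsStable

end OneDimensionalGaussians

open Matrix

/-! ### Gaussian vectors and matrices -/

section GaussianVectors

variable {ι κ κ' : Type*} [Fintype κ] [Fintype κ']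

@[fun_prop]
lemma measurable_mulVec (U : Matrix ι κ ℝ) : Measurable fun x => U *ᵥ x :=
  measurable_pi_lambda _ fun i =>
    (Continuous.dotProduct continuous_const continuous_id : Continuous (U i ⬝ᵥ ·)).measurable

lemma charFun_map_mulVec_pi_gaussianReal [Fintype ι] (v : ℝ≥0) (U : Matrix ι κ ℝ)
    (t : EuclideanSpace ℝ ι) :
    charFun (((Measure.pi fun _ : κ => gaussianReal 0 v).map (U *ᵥ ·)).map (WithLp.toLp 2)) t =
      Complex.exp (-(v * (t.ofLp ⬝ᵥ ((U * Uᵀ) *ᵥ t.ofLp) : ℝ) / 2)) := by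
  have adjoint (x : κ → ℝ) :
      inner ℝ (WithLp.toLp 2 (U *ᵥ x) : EuclideanSpace ℝ ι) t =
        inner ℝ (WithLp.toLp 2 x : EuclideanSpace ℝ κ) (WithLp.toLp 2 (Uᵀ *ᵥ t.ofLp)) := by
    simp only [EuclideanSpace.inner_eq_star_dotProduct, star_trivial]
    rw [dotProduct_mulVec, mulVec_transpose, dotProduct_comm]
  have sum_sq_eq : ∑ k, (Uᵀ *ᵥ t.ofLp) k ^ 2 = t.ofLp ⬝ᵥ ((U * Uᵀ) *ᵥ t.ofLp) := by
    rw [← mulVec_mulVec, dotProduct_mulVec, ← mulVec_transpose]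
    simp only [dotProduct, sq]
  calc _ = charFun ((Measure.pi fun _ : κ => gaussianReal 0 v).map (WithLp.toLp 2))
        (WithLp.toLp 2 (Uᵀ *ᵥ t.ofLp) : EuclideanSpace ℝ κ) := by
        rw [charFun_apply, charFun_apply, integral_map (by fun_prop) (by fun_prop),
          integral_map (by fun_prop) (by fun_prop), integral_map (by fun_prop) (by fun_prop)]
        simp only [adjoint]
    _ = _ := by
        rw [charFun_pi]
        simp only [charFun_gaussianReal, ← Complex.exp_sum, ← sum_sq_eq]
        simp only [Complex.ofReal_zero, mul_zero, zero_mul, zero_sub, Finset.sum_neg_distrib,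
          ← Finset.sum_div, ← Finset.mul_sum, ← Complex.ofReal_pow, ← Complex.ofReal_sum]

lemma map_mulVec_pi_gaussianReal_eq_of_mul_transpose_eq [Finite ι] (v : ℝ≥0)
    {U : Matrix ι κ ℝ} {U' : Matrix ι κ' ℝ} (h : U * Uᵀ = U' * U'ᵀ) :
    (Measure.pi fun _ : κ => gaussianReal 0 v).map (U *ᵥ ·) =
      (Measure.pi fun _ : κ' => gaussianReal 0 v).map (U' *ᵥ ·) := by
  have := Fintype.ofFinite ι
  have := Measure.isProbabilityMeasure_map (μ := Measure.pi fun _ : κ => gaussianReal 0 v)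
    (measurable_mulVec U).aemeasurable
  have := Measure.isProbabilityMeasure_map (μ := Measure.pi fun _ : κ' => gaussianReal 0 v)
    (measurable_mulVec U').aemeasurable
  apply (MeasurableEquiv.toLp 2 (ι → ℝ)).map_measurableEquiv_injective
  change Measure.map (WithLp.toLp 2) _ = Measure.map (WithLp.toLp 2) _
  apply Measure.ext_of_charFun (E := EuclideanSpace ℝ ι)
  ext t
  rw [charFun_map_mulVec_pi_gaussianReal, charFun_map_mulVec_pi_gaussianReal, h]

lemma map_mulVec_pi_gaussianReal_of_mul_transpose_eq_one [DecidableEq κ] (v : ℝ≥0)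
    {U : Matrix κ κ ℝ} (hU : U * Uᵀ = 1) :
    (Measure.pi fun _ : κ => gaussianReal 0 v).map (U *ᵥ ·) =
      Measure.pi fun _ : κ => gaussianReal 0 v := by
  have same_covariance : U * Uᵀ = (1 : Matrix κ κ ℝ) * 1ᵀ := by
    rw [hU, transpose_one, Matrix.one_mul]
  simpa only [one_mulVec, Measure.map_id'] using
    map_mulVec_pi_gaussianReal_eq_of_mul_transpose_eq v same_covariance

lemma map_dotProduct_pi_gaussianReal (v : ℝ≥0) {a : κ → ℝ} {c : ℝ} (h : a ⬝ᵥ a = c ^ 2) :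
    (Measure.pi fun _ : κ => gaussianReal 0 v).map (a ⬝ᵥ ·) = (gaussianReal 0 v).map (c * ·) := by
  have law_row := map_mulVec_pi_gaussianReal_eq_of_mul_transpose_eq v
    (U := replicateRow Unit a) (U' := replicateRow Unit fun _ : Unit => c) (by
      ext
      simpa [mul_apply, dotProduct, sq] using h)
  have law_entry := congr_arg (Measure.map fun y : Unit → ℝ => y ()) law_row
  rw [Measure.map_map (by fun_prop) (by fun_prop), Measure.map_map (by fun_prop) (by fun_prop)]
    at law_entry
  have entry_of_constant_row (y : Unit → ℝ) :
      (replicateRow Unit (fun _ : Unit => c) *ᵥ y) () = c * y () := by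
    simp [mulVec, dotProduct]
  calc _ = (Measure.pi fun _ : Unit => gaussianReal 0 v).map (fun y => c * y ()) := by
        simp only [Function.comp_def, entry_of_constant_row] at law_entry
        exact law_entry
    _ = ((Measure.pi fun _ : Unit => gaussianReal 0 v).map fun y => y ()).map (c * ·) :=
        (Measure.map_map (by fun_prop) (by fun_prop)).symm
    _ = _ := by rw [(measurePreserving_eval (fun _ : Unit => gaussianReal 0 v) ()).map_eq]

end GaussianVectors

section GaussianMatrices

variable {n p d : ℕ} {v : ℝ≥0}

instance : BorelSpace (Matrix (Fin n) (Fin d) ℝ) :=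
  inferInstanceAs (BorelSpace (Fin n → Fin d → ℝ))

instance : SecondCountableTopology (Matrix (Fin n) (Fin d) ℝ) :=
  inferInstanceAs (SecondCountableTopology (Fin n → Fin d → ℝ))

instance : IsProbabilityMeasure (gaussianMatrix n d v) :=
  inferInstanceAs (IsProbabilityMeasure
    (Measure.pi fun _ : Fin n => Measure.pi fun _ : Fin d => gaussianReal 0 v))

@[fun_prop]
lemma measurable_const_mul_matrix (Q : Matrix (Fin n) (Fin p) ℝ) :
    Measurable fun X : Matrix (Fin p) (Fin d) ℝ => Q * X :=
  (Continuous.matrix_mul continuous_const continuous_id).measurable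

lemma measurable_of_uncurry : Measurable fun x : Fin n × Fin d → ℝ =>
    (of fun i j => x (i, j) : Matrix (Fin n) (Fin d) ℝ) :=
  (MeasurableEquiv.curry (Fin n) (Fin d) ℝ).measurable

lemma map_of_uncurry_pi_gaussianReal :
    (Measure.pi fun _ : Fin n × Fin d => gaussianReal 0 v).map
      (fun x => (of fun i j => x (i, j) : Matrix (Fin n) (Fin d) ℝ)) = gaussianMatrix n d v := by
  have curry_law := Measure.infinitePi_map_curry (ι := Fin n) (κ := Fin d)
    fun _ _ => gaussianReal 0 v
  simp only [Measure.infinitePi_eq_pi] at curry_law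
  exact curry_law

open scoped Kronecker in
lemma map_mul_gaussianMatrix_eq_of_mul_transpose_eq {m : ℕ} {B : Matrix (Fin n) (Fin p) ℝ}
    {L : Matrix (Fin n) (Fin m) ℝ} (h : B * Bᵀ = L * Lᵀ) :
    (gaussianMatrix p d v).map (B * ·) = (gaussianMatrix m d v).map (L * ·) := by
  have law_vectorized {q : ℕ} (Q : Matrix (Fin n) (Fin q) ℝ) :
      (gaussianMatrix q d v).map (Q * ·) =
        ((Measure.pi fun _ : Fin q × Fin d => gaussianReal 0 v).map
          ((Q ⊗ₖ (1 : Matrix (Fin d) (Fin d) ℝ)) *ᵥ ·)).map fun x => of fun i j => x (i, j) := by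
    rw [← map_of_uncurry_pi_gaussianReal, Measure.map_map (by fun_prop) measurable_of_uncurry,
      Measure.map_map measurable_of_uncurry (by fun_prop)]
    congr 1
    ext x i j
    simp [mul_apply, mulVec, dotProduct, Fintype.sum_prod_type, one_apply]
  have same_covariance :
      (B ⊗ₖ (1 : Matrix (Fin d) (Fin d) ℝ)) * (B ⊗ₖ (1 : Matrix (Fin d) (Fin d) ℝ))ᵀ =
        (L ⊗ₖ (1 : Matrix (Fin d) (Fin d) ℝ)) * (L ⊗ₖ (1 : Matrix (Fin d) (Fin d) ℝ))ᵀ := by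
    rw [← kroneckerMap_transpose, ← kroneckerMap_transpose, ← mul_kronecker_mul, h,
      ← mul_kronecker_mul]
  rw [law_vectorized, law_vectorized,
    map_mulVec_pi_gaussianReal_eq_of_mul_transpose_eq v same_covariance]

lemma sum_dotProduct_self_eq_frobeniusNorm_sq (X : Matrix (Fin n) (Fin d) ℝ) :
    ∑ i, X i ⬝ᵥ X i = frobeniusNorm X ^ 2 := by
  unfold frobeniusNorm
  rw [frobenius_norm_def, ← Real.sqrt_eq_rpow, Real.sq_sqrt (by positivity)]
  simp [dotProduct, sq]

lemma frobeniusNorm_nonneg (X : Matrix (Fin n) (Fin d) ℝ) : 0 ≤ frobeniusNorm X := by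
  unfold frobeniusNorm
  rw [frobenius_norm_def]
  positivity

lemma trace_transpose_mul_eq_sum_dotProduct (X Y : Matrix (Fin n) (Fin d) ℝ) :
    trace (Xᵀ * Y) = ∑ i, X i ⬝ᵥ Y i := by
  rw [trace_mul_comm]
  exact Finset.sum_congr rfl fun i _ => dotProduct_comm (Y i) (X i)

lemma map_trace_transpose_mul_gaussianMatrix (X : Matrix (Fin n) (Fin d) ℝ) :
    (gaussianMatrix n d v).map (fun G => trace (Xᵀ * G)) =
      (gaussianReal 0 v).map (frobeniusNorm X * ·) := by
  have vec_dotProduct_self :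
      (fun ij : Fin n × Fin d => X ij.1 ij.2) ⬝ᵥ (fun ij => X ij.1 ij.2) = frobeniusNorm X ^ 2 := by
    rw [← sum_dotProduct_self_eq_frobeniusNorm_sq]
    simp [dotProduct, Fintype.sum_prod_type]
  rw [← map_of_uncurry_pi_gaussianReal, Measure.map_map _ measurable_of_uncurry,
    ← map_dotProduct_pi_gaussianReal v vec_dotProduct_self]
  · congr 1
    ext x
    simp [trace_transpose_mul_eq_sum_dotProduct, dotProduct, Fintype.sum_prod_type]
  · exact (Continuous.matrix_trace
      (Continuous.matrix_mul continuous_const continuous_id)).measurable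

end GaussianMatrices

/-! ### Householder reflections -/

section Householder

variable {ι : Type*} [Fintype ι] [DecidableEq ι]

/-- The Householder matrix of the orthogonal reflection in the hyperplane orthogonal to `w`. It is
the identity if `w = 0`, because then `2 / (w ⬝ᵥ w) = 0`. -/
noncomputable def householder (w : ι → ℝ) : Matrix ι ι ℝ :=
  1 - (2 / (w ⬝ᵥ w)) • vecMulVec w w

lemma householder_mulVec (w x : ι → ℝ) :
    householder w *ᵥ x = x - (2 / (w ⬝ᵥ w) * (w ⬝ᵥ x)) • w := by
  ext i
  simp [householder, sub_mulVec, smul_mulVec, vecMulVec_mulVec]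
  ring

lemma householder_mulVec_mulVec (w x : ι → ℝ) : householder w *ᵥ (householder w *ᵥ x) = x := by
  rcases eq_or_ne (w ⬝ᵥ w) 0 with hw | hw
  · simp [householder_mulVec, hw]
  · simp only [householder_mulVec, dotProduct_sub, dotProduct_smul, smul_eq_mul]
    rw [sub_sub, ← add_smul, sub_eq_self]
    convert zero_smul ℝ w
    field_simp
    ring

lemma householder_mul_transpose (w : ι → ℝ) : householder w * (householder w)ᵀ = 1 := by
  have symmetric : (householder w)ᵀ = householder w := by
    simp only [householder, transpose_sub, transpose_one, transpose_smul, transpose_vecMulVec]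
  rw [symmetric, ← mulVec_injective.eq_iff]
  ext x : 1
  rw [← mulVec_mulVec, householder_mulVec_mulVec, one_mulVec]

lemma householder_sub_mulVec {a b : ι → ℝ} (h : a ⬝ᵥ a = b ⬝ᵥ b) :
    householder (a - b) *ᵥ a = b := by
  have norm_sq_sub : (a - b) ⬝ᵥ (a - b) = 2 * ((a - b) ⬝ᵥ a) := by
    simp only [sub_dotProduct, dotProduct_sub, dotProduct_comm b a, ← h]
    ring
  rw [householder_mulVec]
  rcases eq_or_ne ((a - b) ⬝ᵥ (a - b)) 0 with h0 | h0
  · rw [dotProduct_self_eq_zero] at h0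
    simpa [h0] using sub_eq_zero.1 h0
  · have : 2 / ((a - b) ⬝ᵥ (a - b)) * ((a - b) ⬝ᵥ a) = 1 := by
      rw [norm_sq_sub] at h0 ⊢
      rw [div_mul_eq_mul_div, div_self h0]
    rw [this, one_smul, sub_sub_cancel]

@[fun_prop]
lemma measurable_householder_mulVec {Ω : Type*} [MeasurableSpace Ω] {w x : Ω → ι → ℝ}
    (hw : Measurable w) (hx : Measurable x) : Measurable fun ω => householder (w ω) *ᵥ x ω := by
  simp only [householder_mulVec, dotProduct]
  fun_prop

end Householder

section GaussianVectorWithMean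

variable {ι : Type*} [Fintype ι] {v : ℝ≥0}

/-- The law of a vector with independent entries of law `N(a i, v)`. -/
noncomputable def gaussianVector (a : ι → ℝ) (v : ℝ≥0) : Measure (ι → ℝ) :=
  Measure.pi fun i => gaussianReal (a i) v

instance (a : ι → ℝ) : IsProbabilityMeasure (gaussianVector a v) :=
  inferInstanceAs (IsProbabilityMeasure (Measure.pi fun i => gaussianReal (a i) v))

lemma gaussianVector_map_const_add (a b : ι → ℝ) :
    (gaussianVector a v).map (b + ·) = gaussianVector (a + b) v := by
  have coordinatewise := Measure.pi_map_pi (μ := fun i => gaussianReal (a i) v)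
    (f := fun i x => b i + x) (fun i => by fun_prop)
  simp only [gaussianReal_map_const_add] at coordinatewise
  exact coordinatewise

lemma gaussianVector_map_mulVec [DecidableEq ι] {U : Matrix ι ι ℝ} (hU : U * Uᵀ = 1) (a : ι → ℝ) :
    (gaussianVector a v).map (U *ᵥ ·) = gaussianVector (U *ᵥ a) v := by
  have of_centered (b : ι → ℝ) : gaussianVector b v = (gaussianVector 0 v).map (b + ·) := by
    rw [gaussianVector_map_const_add, zero_add]
  have centered : (gaussianVector 0 v).map (U *ᵥ ·) = gaussianVector 0 v :=
    map_mulVec_pi_gaussianReal_of_mul_transpose_eq_one v hU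
  calc _ = (gaussianVector 0 v).map fun x => U *ᵥ (a + x) := by
        rw [of_centered a, Measure.map_map (by fun_prop) (by fun_prop)]
        rfl
    _ = ((gaussianVector 0 v).map (U *ᵥ ·)).map (U *ᵥ a + ·) := by
        rw [Measure.map_map (by fun_prop) (by fun_prop)]
        simp only [mulVec_add, Function.comp_def]
    _ = _ := by rw [centered, ← of_centered]

end GaussianVectorWithMean

section FinCons

variable {n : ℕ}

@[fun_prop]
lemma measurable_finCons {Ω E : Type*} [MeasurableSpace Ω] [MeasurableSpace E]
    {f : Ω → E} {g : Ω → Fin n → E} (hf : Measurable f) (hg : Measurable g) :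
    Measurable fun ω => (Fin.cons (f ω) (g ω) : Fin (n + 1) → E) := by
  refine measurable_pi_lambda _ (Fin.cases ?_ fun i => ?_)
  · simpa using hf
  · simpa [Function.comp_def] using (measurable_pi_apply i).comp hg

@[fun_prop]
lemma measurable_finTail {Ω E : Type*} [MeasurableSpace Ω] [MeasurableSpace E]
    {f : Ω → Fin (n + 1) → E} (hf : Measurable f) : Measurable fun ω => Fin.tail (f ω) :=
  measurable_pi_lambda _ fun i => (measurable_pi_apply i.succ).comp hf

lemma measurePreserving_finCons {E : Type*} [MeasurableSpace E] (μ : Fin (n + 1) → Measure E)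
    [∀ i, SigmaFinite (μ i)] :
    MeasurePreserving (fun q : E × (Fin n → E) => (Fin.cons q.1 q.2 : Fin (n + 1) → E))
      ((μ 0).prod (Measure.pi fun i => μ i.succ)) (Measure.pi μ) := by
  have h : MeasurePreserving (MeasurableEquiv.piFinSuccAbove (fun _ => E) 0).symm
      ((μ 0).prod (Measure.pi fun i => μ i.succ)) (Measure.pi μ) :=
    (measurePreserving_piFinSuccAbove μ 0).symm
  convert h using 1
  ext q : 1
  exact (Fin.insertNth_zero' _ _).symm

lemma measurePreserving_zero_tail {E : Type*} [MeasurableSpace E] (μ : Fin (n + 1) → Measure E)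
    [∀ i, SigmaFinite (μ i)] :
    MeasurePreserving (fun w : Fin (n + 1) → E => (w 0, Fin.tail w))
      (Measure.pi μ) ((μ 0).prod (Measure.pi fun i => μ i.succ)) :=
  measurePreserving_piFinSuccAbove μ 0

end FinCons

section SpendMean

variable {d : ℕ}

/-- A reflection of `ℝ × ℝ^d` that takes the mean `(m, 0)` to `(√(m² - |δ|²), δ)`: part of the
mean of the first coordinate is spent on the shift `δ` of the others. -/
noncomputable def spendMean (m : ℝ) (δ : Fin d → ℝ) (q : ℝ × (Fin d → ℝ)) : ℝ × (Fin d → ℝ) :=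
  let z : Fin (d + 1) → ℝ :=
    householder (Fin.cons m 0 - Fin.cons √(m ^ 2 - δ ⬝ᵥ δ) δ) *ᵥ Fin.cons q.1 q.2
  (z 0, Fin.tail z)

@[fun_prop]
lemma measurable_spendMean {Ω : Type*} [MeasurableSpace Ω] {m : Ω → ℝ} {δ : Ω → Fin d → ℝ}
    {q : Ω → ℝ × (Fin d → ℝ)} (hm : Measurable m) (hδ : Measurable δ) (hq : Measurable q) :
    Measurable fun ω => spendMean (m ω) (δ ω) (q ω) := by
  simp only [spendMean, dotProduct]
  fun_prop

lemma measurePreserving_spendMean (v : ℝ≥0) {m : ℝ} {δ : Fin d → ℝ} (h : δ ⬝ᵥ δ ≤ m ^ 2) (t : ℝ) :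
    MeasurePreserving (spendMean m δ) ((gaussianReal (t * m) v).prod (gaussianVector 0 v))
      ((gaussianReal (t * √(m ^ 2 - δ ⬝ᵥ δ)) v).prod (gaussianVector (t • δ) v)) := by
  set a : Fin (d + 1) → ℝ := Fin.cons m 0 with ha
  set b : Fin (d + 1) → ℝ := Fin.cons √(m ^ 2 - δ ⬝ᵥ δ) δ with hb
  have same_norm : a ⬝ᵥ a = b ⬝ᵥ b :=
    calc a ⬝ᵥ a = m * m + 0 ⬝ᵥ 0 := cons_dotProduct_cons m 0 m 0
      _ = √(m ^ 2 - δ ⬝ᵥ δ) * √(m ^ 2 - δ ⬝ᵥ δ) + δ ⬝ᵥ δ := by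
        rw [Real.mul_self_sqrt (sub_nonneg.2 h), dotProduct_zero]
        ring
      _ = b ⬝ᵥ b := (cons_dotProduct_cons _ δ _ δ).symm
  have reflection : MeasurePreserving (householder (a - b) *ᵥ ·)
      (gaussianVector (t • a) v) (gaussianVector (t • b) v) := by
    refine ⟨by fun_prop, ?_⟩
    rw [gaussianVector_map_mulVec (householder_mul_transpose _), mulVec_smul,
      householder_sub_mulVec same_norm]
  have smul_finCons (c : ℝ) (x : Fin d → ℝ) :
      t • (Fin.cons c x : Fin (d + 1) → ℝ) = Fin.cons (t * c) (t • x) := smul_cons t c x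
  rw [ha, hb, smul_finCons, smul_finCons, smul_zero] at reflection
  exact (measurePreserving_zero_tail fun i => gaussianReal _ v).comp
    (reflection.comp (measurePreserving_finCons fun i => gaussianReal _ v))

end SpendMean

/-! ### Simulation of an adaptively chosen shift -/

lemma map_prod_congr {α β γ δ : Type*} [MeasurableSpace α] [MeasurableSpace β] [MeasurableSpace γ]
    [MeasurableSpace δ] (μ : Measure α) {ν : Measure β} {ν' : Measure γ} [SFinite ν] [SFinite ν']
    {f : α × β → δ} {g : α × γ → δ} (hf : Measurable f) (hg : Measurable g)
    (h : ∀ a, ν.map (fun b => f (a, b)) = ν'.map (fun c => g (a, c))) :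
    (μ.prod ν).map f = (μ.prod ν').map g := by
  ext S hS
  rw [Measure.map_apply hf hS, Measure.map_apply hg hS, Measure.prod_apply (hf hS),
    Measure.prod_apply (hg hS)]
  refine lintegral_congr fun a => ?_
  have section_law := congr_arg (· S) (h a)
  rwa [Measure.map_apply (by fun_prop) hS, Measure.map_apply (by fun_prop) hS] at section_law

/-- `U w i` depends only on the coordinates of `w` before the `i`-th. -/
def StrictlyCausal {n : ℕ} {E F : Type*} (U : (Fin n → E) → Fin n → F) : Prop :=
  ∀ i w w', (∀ j < i, w j = w' j) → U w i = U w' i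

namespace StrictlyCausal

variable {n : ℕ} {E F : Type*} {U : (Fin (n + 1) → E) → Fin (n + 1) → F}

lemma apply_zero (hU : StrictlyCausal U) (w w' : Fin (n + 1) → E) : U w 0 = U w' 0 :=
  hU 0 w w' fun _ hj => absurd hj (Fin.not_lt_zero _)

lemma tail (hU : StrictlyCausal U) (x : E) :
    StrictlyCausal fun w => Fin.tail (U (Fin.cons x w)) := fun i _ _ h =>
  hU i.succ _ _ (Fin.cases (fun _ => rfl) fun j hj => h j (Fin.succ_lt_succ_iff.1 hj))

end StrictlyCausal

/-- A mean `base r w + t • diff r w` for `n` Gaussian rows, given randomness `r`, in which row `i`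
depends only on the values `w` of the rows before it. An adversary chooses it row by row, and
`t` selects one of the two hypotheses (`t = 0` or `t = 1`) to be told apart. -/
structure AdaptiveShift (R : Type*) [MeasurableSpace R] (n d : ℕ) where
  base : R → (Fin n → Fin d → ℝ) → Fin n → Fin d → ℝ
  diff : R → (Fin n → Fin d → ℝ) → Fin n → Fin d → ℝ
  measurable_base : Measurable (Function.uncurry base)
  measurable_diff : Measurable (Function.uncurry diff)
  strictlyCausal_base : ∀ r, StrictlyCausal (base r)
  strictlyCausal_diff : ∀ r, StrictlyCausal (diff r)

namespace AdaptiveShift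

variable {R : Type*} [MeasurableSpace R] {n d : ℕ}

attribute [fun_prop] measurable_base measurable_diff

/-- What remains after the first row has been released; its value joins the randomness. -/
def tail (A : AdaptiveShift R (n + 1) d) : AdaptiveShift (R × (Fin d → ℝ)) n d where
  base s w := Fin.tail (A.base s.1 (Fin.cons s.2 w))
  diff s w := Fin.tail (A.diff s.1 (Fin.cons s.2 w))
  measurable_base := by
    simp only [Function.uncurry_def]
    fun_prop
  measurable_diff := by
    simp only [Function.uncurry_def]
    fun_prop
  strictlyCausal_base s := (A.strictlyCausal_base s.1).tail s.2
  strictlyCausal_diff s := (A.strictlyCausal_diff s.1).tail s.2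

/-- `W` maps the centered noise `G` to rows with mean `base r + t • diff r` and noise `G`. -/
structure IsResponse (A : AdaptiveShift R n d) (r : R) (t : ℝ)
    (W : (Fin n → Fin d → ℝ) → Fin n → Fin d → ℝ) : Prop where
  measurable : Measurable W
  eq_add : ∀ G, W G = A.base r (W G) + t • A.diff r (W G) + G

lemma IsResponse.cons {A : AdaptiveShift R (n + 1) d} {r : R} {t : ℝ}
    {W : (Fin (n + 1) → Fin d → ℝ) → Fin (n + 1) → Fin d → ℝ} (hW : A.IsResponse r t W)
    (x : Fin d → ℝ) (G : Fin n → Fin d → ℝ) :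
    W (Fin.cons x G) = Fin.cons (A.base r 0 0 + t • A.diff r 0 0 + x)
      (Fin.tail (W (Fin.cons x G))) := by
  have h := congr_fun (hW.eq_add (Fin.cons x G)) 0
  simp only [Pi.add_apply, Pi.smul_apply, Fin.cons_zero,
    (A.strictlyCausal_base r).apply_zero _ 0, (A.strictlyCausal_diff r).apply_zero _ 0] at h
  rw [← h, Fin.cons_self_tail]

lemma IsResponse.tail {A : AdaptiveShift R (n + 1) d} {r : R} {t : ℝ}
    {W : (Fin (n + 1) → Fin d → ℝ) → Fin (n + 1) → Fin d → ℝ} (hW : A.IsResponse r t W)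
    (x : Fin d → ℝ) :
    A.tail.IsResponse (r, A.base r 0 0 + t • A.diff r 0 0 + x) t
      fun G => Fin.tail (W (Fin.cons x G)) where
  measurable := measurable_finTail (hW.measurable.comp (by fun_prop))
  eq_add G := by
    have h := congr_arg Fin.tail (hW.eq_add (Fin.cons x G))
    rwa [hW.cons] at h

/-- The rows computed from a single real number, which carries the whole mean, and from centered
noise: before each row, `spendMean` moves as much of that mean as the row requires. -/
noncomputable def simulate : {n : ℕ} → {R : Type*} → [MeasurableSpace R] → AdaptiveShift R n d →
    R → ℝ → ℝ × (Fin n → Fin d → ℝ) → Fin n → Fin d → ℝ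
  | 0, _, _, _, _, _, _ => 0
  | _ + 1, _, _, A, r, m, q =>
    let δ := A.diff r 0 0
    let z := spendMean m δ (q.1, q.2 0)
    let w₀ := A.base r 0 0 + z.2
    Fin.cons w₀ (simulate A.tail (r, w₀) √(m ^ 2 - δ ⬝ᵥ δ) (z.1, Fin.tail q.2))

@[fun_prop]
lemma measurable_simulate {Ω : Type*} [MeasurableSpace Ω] (A : AdaptiveShift R n d) {r : Ω → R}
    {m : Ω → ℝ} {q : Ω → ℝ × (Fin n → Fin d → ℝ)} (hr : Measurable r) (hm : Measurable m)
    (hq : Measurable q) : Measurable fun ω => A.simulate (r ω) (m ω) (q ω) := by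
  induction n generalizing R m with
  | zero => exact measurable_const
  | succ n ih =>
    simp only [simulate, dotProduct]
    refine measurable_finCons ?_ (ih A.tail ?_ ?_ ?_) <;> fun_prop

variable (v : ℝ≥0)

lemma map_simulate_succ (A : AdaptiveShift R (n + 1) d) (r : R) {m : ℝ}
    (hm : A.diff r 0 0 ⬝ᵥ A.diff r 0 0 ≤ m ^ 2) (t : ℝ) :
    ((gaussianReal (t * m) v).prod (Measure.pi fun _ => gaussianVector 0 v)).map (A.simulate r m) =
      ((gaussianVector 0 v).prod
        ((gaussianReal (t * √(m ^ 2 - A.diff r 0 0 ⬝ᵥ A.diff r 0 0)) v).prod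
          (Measure.pi fun _ => gaussianVector 0 v))).map fun s =>
          Fin.cons (A.base r 0 0 + t • A.diff r 0 0 + s.1)
            (A.tail.simulate (r, A.base r 0 0 + t • A.diff r 0 0 + s.1)
              √(m ^ 2 - A.diff r 0 0 ⬝ᵥ A.diff r 0 0) s.2) := by
  set u := A.base r 0 0
  set δ := A.diff r 0 0
  set c := √(m ^ 2 - δ ⬝ᵥ δ)
  set γ : Measure (Fin d → ℝ) := gaussianVector 0 v
  let F : (ℝ × (Fin d → ℝ)) × (Fin n → Fin d → ℝ) → Fin (n + 1) → Fin d → ℝ := fun s =>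
    Fin.cons (u + s.1.2) (A.tail.simulate (r, u + s.1.2) c (s.1.1, s.2))
  have hF : Measurable F := by fun_prop
  have isolate_first_row : MeasurePreserving (fun q => ((q.1, q.2 0), Fin.tail q.2))
      ((gaussianReal (t * m) v).prod (Measure.pi fun _ : Fin (n + 1) => γ))
      (((gaussianReal (t * m) v).prod γ).prod (Measure.pi fun _ : Fin n => γ)) :=
    (measurePreserving_prodAssoc _ _ _).symm.comp
      ((MeasurePreserving.id _).prod (measurePreserving_zero_tail fun _ => γ))
  have spend := (measurePreserving_spendMean v hm t).prod
    (MeasurePreserving.id (Measure.pi fun _ : Fin n => γ))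
  have shift : MeasurePreserving (t • δ + ·) γ (gaussianVector (t • δ) v) :=
    ⟨by fun_prop, by rw [gaussianVector_map_const_add, zero_add]⟩
  have reorder : MeasurePreserving (fun s => ((s.2.1, t • δ + s.1), s.2.2))
      (γ.prod ((gaussianReal (t * c) v).prod (Measure.pi fun _ : Fin n => γ)))
      (((gaussianReal (t * c) v).prod (gaussianVector (t • δ) v)).prod
        (Measure.pi fun _ : Fin n => γ)) :=
    (((MeasurePreserving.id _).prod shift).comp Measure.measurePreserving_swap).prod
      (MeasurePreserving.id _) |>.comp (measurePreserving_prodAssoc _ _ _).symm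
  calc _ = (((gaussianReal (t * c) v).prod (gaussianVector (t • δ) v)).prod
        (Measure.pi fun _ : Fin n => γ)).map F := by
        rw [← (spend.comp isolate_first_row).map_eq,
          Measure.map_map hF (spend.comp isolate_first_row).measurable]
        rfl
    _ = _ := by
        rw [← reorder.map_eq, Measure.map_map hF reorder.measurable]
        simp only [F, Function.comp_def, add_assoc]

theorem map_simulate (A : AdaptiveShift R n d) (r : R) {m : ℝ}
    (hm : ∀ w, ∑ i, A.diff r w i ⬝ᵥ A.diff r w i ≤ m ^ 2) {t : ℝ}
    {W : (Fin n → Fin d → ℝ) → Fin n → Fin d → ℝ} (hW : A.IsResponse r t W) :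
    ((gaussianReal (t * m) v).prod (Measure.pi fun _ : Fin n => gaussianVector 0 v)).map
      (A.simulate r m) = (Measure.pi fun _ : Fin n => gaussianVector 0 v).map W := by
  induction n generalizing R m with
  | zero =>
    rw [Subsingleton.elim W fun _ => 0, Subsingleton.elim (A.simulate r m) fun _ => 0]
    simp
  | succ n ih =>
    have first_le (w) : A.diff r 0 0 ⬝ᵥ A.diff r 0 0 +
        ∑ i : Fin n, A.diff r w i.succ ⬝ᵥ A.diff r w i.succ ≤ m ^ 2 := by
      rw [← (A.strictlyCausal_diff r).apply_zero w 0, ← Fin.sum_univ_succ fun i =>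
        A.diff r w i ⬝ᵥ A.diff r w i]
      exact hm w
    have hδ : A.diff r 0 0 ⬝ᵥ A.diff r 0 0 ≤ m ^ 2 :=
      (le_add_of_nonneg_right (Finset.sum_nonneg fun i _ =>
        Finset.sum_nonneg fun j _ => mul_self_nonneg _)).trans (first_le 0)
    rw [map_simulate_succ v A r hδ,
      ← (measurePreserving_finCons fun _ => gaussianVector 0 v).map_eq,
      Measure.map_map hW.measurable (by fun_prop)]
    refine map_prod_congr _ (by fun_prop) (hW.measurable.comp (by fun_prop)) fun x => ?_
    set w₀ := A.base r 0 0 + t • A.diff r 0 0 + x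
    have rest := ih A.tail (r, w₀) (m := √(m ^ 2 - A.diff r 0 0 ⬝ᵥ A.diff r 0 0)) (fun w => by
      rw [Real.sq_sqrt (sub_nonneg.2 hδ), le_sub_iff_add_le']
      exact first_le (Fin.cons w₀ w)) (hW.tail x)
    have glued := congr_arg
      (Measure.map fun w => (Fin.cons w₀ w : Fin (n + 1) → Fin d → ℝ)) rest
    rw [Measure.map_map (by fun_prop) (by fun_prop), Measure.map_map (by fun_prop)
      (hW.tail x).measurable] at glued
    have restore (G) : Fin.cons w₀ (Fin.tail (W (Fin.cons x G))) = W (Fin.cons x G) :=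
      (hW.cons x G).symm
    simpa only [Function.comp_def, restore] using glued

end AdaptiveShift

/-! ### Lower triangular factorizations -/

section Triangular

variable {n d : ℕ}

lemma mul_row_congr_of_isLowerTriangular {L : Matrix (Fin n) (Fin n) ℝ}
    (hL : L.IsLowerTriangular) {X X' : Matrix (Fin n) (Fin d) ℝ} {i : Fin n}
    (h : ∀ k ≤ i, X k = X' k) : (L * X) i = (L * X') i := by
  ext j
  simp only [Matrix.mul_apply]
  refine Finset.sum_congr rfl fun k _ => ?_
  rcases le_or_gt k i with hk | hk
  · rw [h k hk]
  · rw [hL (by simpa using hk), zero_mul, zero_mul]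

lemma exists_isLowerTriangular_sum_smul {E : Type*} [AddCommGroup E] [Module ℝ E] {f g : Fin n → E}
    (h : ∀ i, f i ∈ Submodule.span ℝ (g '' Set.Iic i)) :
    ∃ T : Matrix (Fin n) (Fin n) ℝ, T.IsLowerTriangular ∧ ∀ i, ∑ k, T i k • g k = f i := by
  have combination (i : Fin n) :
      ∃ c : Fin n → ℝ, (∀ k, i < k → c k = 0) ∧ ∑ k, c k • g k = f i := by
    obtain ⟨c, hc, hsum⟩ := (Finsupp.mem_span_image_iff_linearCombination ℝ).1 (h i)
    refine ⟨c, fun k hk => (Finsupp.mem_supported' ℝ c).1 hc k (by simpa using hk), ?_⟩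
    rw [← hsum, Finsupp.linearCombination_apply, Finsupp.sum_fintype _ _ fun k => zero_smul ℝ (g k)]
  choose T hT hsum using combination
  exact ⟨T, fun i k hik => hT i k (by simpa using hik), hsum⟩

open InnerProductSpace in
lemma exists_orthogonal_rows_isLowerTriangular {p : ℕ} (B : Matrix (Fin n) (Fin p) ℝ) :
    ∃ (Q : Matrix (Fin n) (Fin p) ℝ) (T D : Matrix (Fin n) (Fin n) ℝ),
      T.IsLowerTriangular ∧ D.IsLowerTriangular ∧ T * B = Q ∧ D * Q = B ∧
      (Q * Qᵀ).IsDiag ∧ Q * Qᵀ * Q = Q := by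
  set b : Fin n → EuclideanSpace ℝ (Fin p) := fun i => WithLp.toLp 2 (B i)
  set q := gramSchmidtNormed ℝ b
  set Q : Matrix (Fin n) (Fin p) ℝ := Matrix.of fun i => (q i).ofLp with hQ
  have span_eq (i : Fin n) :
      Submodule.span ℝ (q '' Set.Iic i) = Submodule.span ℝ (b '' Set.Iic i) :=
    (span_gramSchmidtNormed b (Set.Iic i)).trans (span_gramSchmidt_Iic ℝ b i)
  have mem_span (f : Fin n → EuclideanSpace ℝ (Fin p)) (i : Fin n) :
      f i ∈ Submodule.span ℝ (f '' Set.Iic i) :=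
    Submodule.subset_span (Set.mem_image_of_mem f Set.self_mem_Iic)
  obtain ⟨T, hT, hTb⟩ := exists_isLowerTriangular_sum_smul fun i => span_eq i ▸ mem_span q i
  obtain ⟨D, hD, hDq⟩ := exists_isLowerTriangular_sum_smul fun i => (span_eq i).symm ▸ mem_span b i
  have orthogonal {i j : Fin n} (hij : i ≠ j) : inner ℝ (q i) (q j) = 0 := by
    simp only [q, gramSchmidtNormed, inner_smul_left, inner_smul_right,
      gramSchmidt_orthogonal ℝ b hij, mul_zero]
  have isDiag : (Q * Qᵀ).IsDiag := fun i j hij => orthogonal hij.symm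
  refine ⟨Q, T, D, hT, hD, ?_, ?_, isDiag, ?_⟩
  · ext i j
    simpa [Matrix.mul_apply, b, hQ] using congrArg (fun x => x.ofLp j) (hTb i)
  · ext i j
    simpa [Matrix.mul_apply, b, hQ] using congrArg (fun x => x.ofLp j) (hDq i)
  · ext i j
    rw [Matrix.mul_apply, Finset.sum_eq_single i (fun k _ hk => by rw [isDiag hk.symm, zero_mul])
      (by simp)]
    change inner ℝ (q i) (q i) * (q i).ofLp j = (q i).ofLp j
    by_cases hi : q i = 0
    · simp [hi]
    · rw [real_inner_self_eq_norm_sq, gramSchmidtNormed_unit_length' hi, one_pow, one_mul]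

lemma exists_isLowerTriangular_factorization {p : ℕ} {B : Matrix (Fin n) (Fin p) ℝ}
    {C : Matrix (Fin p) (Fin n) ℝ} (hA : (B * C).IsLowerTriangular) :
    ∃ L V K : Matrix (Fin n) (Fin n) ℝ, L.IsLowerTriangular ∧ V.IsLowerTriangular ∧
      B * Bᵀ = L * Lᵀ ∧ B * C = L * V ∧ V = Lᵀ * K := by
  obtain ⟨Q, T, D, hT, hD, hTB, hDQ, hdiag, hQ⟩ := exists_orthogonal_rows_isLowerTriangular B
  have hB : B * Qᵀ * Q = B := by rw [← hDQ, Matrix.mul_assoc D, Matrix.mul_assoc D, hQ]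
  have hV : T * (B * C) = Q * C := by rw [← Matrix.mul_assoc, hTB]
  have hL : (B * Qᵀ).IsLowerTriangular := by
    rw [← hDQ, Matrix.mul_assoc]
    exact hD.mul fun i j hij => hdiag (by rintro rfl; exact lt_irrefl _ hij)
  refine ⟨B * Qᵀ, Q * C, Tᵀ * (Q * C), hL, hV ▸ hT.mul hA, ?_, ?_, ?_⟩
  · rw [transpose_mul, transpose_transpose, ← Matrix.mul_assoc, hB]
  · rw [← Matrix.mul_assoc, hB]
  · rw [transpose_mul, transpose_transpose, ← Matrix.mul_assoc, Matrix.mul_assoc Q,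
      ← transpose_mul, hTB, ← Matrix.mul_assoc, hQ]

end Triangular

/-! ### Transcripts -/

section Transcript

variable {n d : ℕ} {R W : Type} [MeasurableSpace R]

lemma transcript_row_eq (M : W → DataStream n d → DataStream n d) (s : Strategy n d R) (r : R)
    (z : W) {k : ℕ} {i : Fin n} (hi : (i : ℕ) < k) :
    transcript M s r z k i = transcript M s r z (i + 1) i := by
  induction k with
  | zero => omega
  | succ k ih =>
    by_cases h : (i : ℕ) = k
    · rw [h]
    · exact (if_neg h).trans (ih (by omega))

lemma stream_row_congr (s : Strategy n d R) (r : R) {y y' : DataStream n d} {i : Fin n}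
    (h : ∀ j < i, y j = y' j) : s.stream r y i = s.stream r y' i :=
  congrArg (s.row i r) (funext fun j => h j j.2)

lemma transcript_eq_of_causal {M : W → DataStream n d → DataStream n d} {z : W}
    (hM : ∀ x x' i, (∀ k ≤ i, x k = x' k) → M z x i = M z x' i) (s : Strategy n d R) (r : R) :
    transcript M s r z n = M z (s.stream r (transcript M s r z n)) := by
  funext i
  rw [transcript_row_eq M s r z i.2]
  refine (if_pos rfl).trans (hM _ _ i fun k hk => ?_)
  refine (if_pos (by exact_mod_cast hk)).trans (stream_row_congr s r fun j hj => ?_)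
  rw [transcript_row_eq M s r z j.2, transcript_row_eq M s r z (hj.trans_le hk)]

lemma transcript_comp {W' : Type} (M : W' → DataStream n d → DataStream n d) (g : W → W')
    (s : Strategy n d R) (r : R) (z : W) (k : ℕ) :
    transcript (fun z => M (g z)) s r z k = transcript M s r (g z) k := by
  induction k with
  | zero => rfl
  | succ k ih => simp only [transcript, ih]

lemma measurable_row (i : Fin n) : Measurable fun X : Matrix (Fin n) (Fin d) ℝ => X i :=
  measurable_pi_apply (X := fun _ : Fin n => Fin d → ℝ) i

lemma measurable_stream (s : Strategy n d R) : Measurable (Function.uncurry s.stream) :=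
  measurable_pi_lambda _ fun i => (s.measurable_row i).comp
    (measurable_fst.prodMk (measurable_pi_lambda _ fun j =>
      (measurable_row j.1).comp measurable_snd))

variable [MeasurableSpace W]

lemma measurable_transcript {M : W → DataStream n d → DataStream n d}
    (hM : Measurable (Function.uncurry M)) (s : Strategy n d R) (k : ℕ) :
    Measurable (Function.uncurry fun r z => transcript M s r z k) := by
  induction k with
  | zero => exact measurable_const
  | succ k ih =>
    have stream_measurable := (measurable_stream s).comp (measurable_fst.prodMk ih)
    have input_measurable : Measurable fun q : R × W => (Matrix.of fun j : Fin n =>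
        if (j : ℕ) ≤ k then s.stream q.1 (transcript M s q.1 q.2 k) j else 0) :=
      measurable_pi_lambda _ fun j => Measurable.ite (MeasurableSet.const _)
        ((measurable_row j).comp stream_measurable) measurable_const
    exact measurable_pi_lambda _ fun i => Measurable.ite (MeasurableSet.const _)
      ((measurable_row i).comp (hM.comp (measurable_snd.prodMk input_measurable)))
      ((measurable_row i).comp ih)

lemma measurable_view {M : W → DataStream n d → DataStream n d}
    (hM : Measurable (Function.uncurry M)) (s : Strategy n d R) :
    Measurable fun q : R × W => (q.1, transcript M s q.1 q.2 n) :=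
  measurable_fst.prodMk (measurable_transcript hM s n)

end Transcript

section NoiseLaw

variable {n d : ℕ} {priv : PrivacyNotion} {N : Set (DataStream n d × DataStream n d)} {W W' : Type}
  [MeasurableSpace W] [MeasurableSpace W'] {noise : Measure W} {g : W → W'}
  {M : W' → DataStream n d → DataStream n d}

lemma nonadaptivelyPrivate_map_iff (hg : Measurable g) (hM : ∀ x, Measurable fun z => M z x) :
    NonadaptivelyPrivate priv N (noise.map g) M ↔
      NonadaptivelyPrivate priv N noise fun z => M (g z) := by
  simp only [NonadaptivelyPrivate, Measure.map_map (hM _) hg, Function.comp_def]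

lemma viewLaw_map {R : Type} [MeasurableSpace R] (seed : Measure R) [SFinite seed] [SFinite noise]
    (hg : Measurable g) (hM : Measurable (Function.uncurry M)) (s : Strategy n d R) :
    viewLaw seed (noise.map g) M s = viewLaw seed noise (fun z => M (g z)) s := by
  have h := Measure.map_prod_map seed noise measurable_id hg
  rw [Measure.map_id] at h
  rw [viewLaw, h, Measure.map_map (measurable_view hM s) (measurable_id.prodMap hg)]
  exact congrArg (Measure.map · _) (funext fun q =>
    Prod.ext rfl (transcript_comp M g s q.1 q.2 n).symm)

lemma adaptivelyPrivate_map_iff [SFinite noise] (hg : Measurable g)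
    (hM : Measurable (Function.uncurry M)) :
    AdaptivelyPrivate priv N (noise.map g) M ↔ AdaptivelyPrivate priv N noise fun z => M (g z) := by
  refine forall₃_congr fun R _ seed => forall_congr' fun _ => ?_
  simp only [viewLaw_map seed hg hM]

end NoiseLaw

/-! ### The matrix mechanism -/

/-- The product `A x`, released with the additive noise `Y`. The matrix mechanism `B (C x + Z)` is
the case `A = B C`, `Y = B Z`, so that its privacy depends only on `B C` and the law of `B Z`. -/
def additiveMechanism {n d : ℕ} (A : Matrix (Fin n) (Fin n) ℝ) (Y : DataStream n d)
    (x : DataStream n d) : DataStream n d :=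
  A * x + Y

section MatrixMechanism

variable {n p d : ℕ} {B : Matrix (Fin n) (Fin p) ℝ} {C : Matrix (Fin p) (Fin n) ℝ}

lemma matrixMechanism_eq (Z : Matrix (Fin p) (Fin d) ℝ) :
    matrixMechanism B C Z = additiveMechanism (B * C) (B * Z) :=
  funext fun x => by rw [matrixMechanism, additiveMechanism, Matrix.mul_add, Matrix.mul_assoc]

lemma measurable_matrixMechanism (B : Matrix (Fin n) (Fin p) ℝ) (C : Matrix (Fin p) (Fin n) ℝ) :
    Measurable (Function.uncurry (matrixMechanism (d := d) B C)) :=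
  (measurable_const_mul_matrix B).comp
    (((measurable_const_mul_matrix C).comp measurable_snd).add measurable_fst)

lemma measurable_additiveMechanism (A : Matrix (Fin n) (Fin n) ℝ) :
    Measurable (Function.uncurry (additiveMechanism (d := d) A)) :=
  ((measurable_const_mul_matrix A).comp measurable_snd).add measurable_fst

variable {priv : PrivacyNotion} {N : Set (DataStream n d × DataStream n d)} {v : ℝ≥0}

lemma nonadaptivelyPrivate_matrixMechanism_iff :
    NonadaptivelyPrivate priv N (gaussianMatrix p d v) (matrixMechanism B C) ↔
      NonadaptivelyPrivate priv N ((gaussianMatrix p d v).map (B * ·))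
        (additiveMechanism (B * C)) := by
  simp only [nonadaptivelyPrivate_map_iff (measurable_const_mul_matrix B)
    fun _ => (measurable_additiveMechanism (B * C)).of_uncurry_right, ← matrixMechanism_eq]

lemma adaptivelyPrivate_matrixMechanism_iff :
    AdaptivelyPrivate priv N (gaussianMatrix p d v) (matrixMechanism B C) ↔
      AdaptivelyPrivate priv N ((gaussianMatrix p d v).map (B * ·))
        (additiveMechanism (B * C)) := by
  simp only [adaptivelyPrivate_map_iff (measurable_const_mul_matrix B)
    (measurable_additiveMechanism (B * C)), ← matrixMechanism_eq]

lemma transcript_matrixMechanism (hA : (B * C).IsLowerTriangular) {R : Type} [MeasurableSpace R]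
    (s : Strategy n d R) (r : R) (Z : Matrix (Fin p) (Fin d) ℝ) :
    transcript (matrixMechanism B C) s r Z n =
      B * (C * s.stream r (transcript (matrixMechanism B C) s r Z n) + Z) := by
  refine transcript_eq_of_causal (fun x x' i h => ?_) s r
  simp only [matrixMechanism_eq, additiveMechanism]
  exact congrArg (· + (B * Z) i) (mul_row_congr_of_isLowerTriangular hA h)

end MatrixMechanism

/-! ### From nonadaptive to adaptive privacy -/

section Adaptivity

variable {n d : ℕ} {priv : PrivacyNotion} {N : Set (DataStream n d × DataStream n d)} {v : ℝ≥0}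

lemma map_inv_mul_trace_gaussianMatrix {X : Matrix (Fin n) (Fin d) ℝ} (hX : frobeniusNorm X ≠ 0) :
    (gaussianMatrix n d v).map (fun G => (frobeniusNorm X)⁻¹ * trace (Xᵀ * G)) =
      gaussianReal 0 v := by
  have h := congrArg (Measure.map ((frobeniusNorm X)⁻¹ * ·))
    (map_trace_transpose_mul_gaussianMatrix (v := v) X)
  rw [Measure.map_map (by fun_prop) (by fun_prop), Measure.map_map (by fun_prop) (by fun_prop)] at h
  simpa [Function.comp_def, inv_mul_cancel_left₀ hX] using h

lemma NonadaptivelyPrivate.gaussianReal_frobeniusNorm (hpriv : priv.IsStable) {m : ℕ}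
    {L : Matrix (Fin n) (Fin m) ℝ} {K : Matrix (Fin n) (Fin n) ℝ}
    (h : NonadaptivelyPrivate priv N (gaussianMatrix m d v) (matrixMechanism L (Lᵀ * K)))
    {x x' : DataStream n d} (hx : (x, x') ∈ N) :
    priv ℝ (gaussianReal 0 v) (gaussianReal (frobeniusNorm (Lᵀ * K * (x' - x))) v) := by
  set V := Lᵀ * K with hV
  set X := V * (x' - x) with hX
  obtain hX0 | hX0 := eq_or_ne (frobeniusNorm X) 0
  · rw [hX0]
    exact hpriv.refl _
  let project (y : DataStream n d) : ℝ :=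
    (frobeniusNorm X)⁻¹ * trace ((K * (x' - x))ᵀ * (y - L * (V * x)))
  have measurable_project : Measurable project := by fun_prop
  have project_output (u : DataStream n d) (Z : Matrix (Fin m) (Fin d) ℝ) :
      project (matrixMechanism L V Z u) =
        (frobeniusNorm X)⁻¹ * trace (Xᵀ * (V * (u - x))) +
          (frobeniusNorm X)⁻¹ * trace (Xᵀ * Z) := by
    have hXt : (K * (x' - x))ᵀ * L = Xᵀ := by
      rw [hX, hV, Matrix.mul_assoc, transpose_mul Lᵀ, transpose_transpose]
    simp only [project, matrixMechanism]
    rw [← Matrix.mul_sub, add_sub_right_comm, ← Matrix.mul_sub, ← Matrix.mul_assoc, hXt,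
      Matrix.mul_add, trace_add, mul_add]
  have law_project (u : DataStream n d) :
      ((gaussianMatrix m d v).map fun Z => matrixMechanism L V Z u).map project =
        gaussianReal ((frobeniusNorm X)⁻¹ * trace (Xᵀ * (V * (u - x)))) v := by
    rw [Measure.map_map measurable_project (measurable_matrixMechanism L V).of_uncurry_right,
      ← zero_add ((frobeniusNorm X)⁻¹ * _), ← gaussianReal_map_const_add,
      ← map_inv_mul_trace_gaussianMatrix hX0, Measure.map_map (by fun_prop) (by fun_prop)]
    simp only [Function.comp_def, project_output]
  have hX_sq : (frobeniusNorm X)⁻¹ * trace (Xᵀ * X) = frobeniusNorm X := by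
    rw [trace_transpose_mul_eq_sum_dotProduct, sum_dotProduct_self_eq_frobeniusNorm_sq, sq,
      inv_mul_cancel_left₀ hX0]
  have output_isProbabilityMeasure (u : DataStream n d) :
      IsProbabilityMeasure ((gaussianMatrix m d v).map fun Z => matrixMechanism L V Z u) :=
    Measure.isProbabilityMeasure_map (measurable_matrixMechanism L V).of_uncurry_right.aemeasurable
  have projected := hpriv.map measurable_project (h x x' hx)
  rw [law_project, law_project, sub_self, Matrix.mul_zero, Matrix.mul_zero, trace_zero, mul_zero,
    ← hX, hX_sq] at projected
  exact projected

lemma stream_mul_row_congr {R : Type} [MeasurableSpace R] (s : Strategy n d R) (r : R)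
    {L : Matrix (Fin n) (Fin n) ℝ} (hL : L.IsLowerTriangular) {w w' : Matrix (Fin n) (Fin d) ℝ}
    {i k : Fin n} (hk : k ≤ i) (h : ∀ j < i, w j = w' j) :
    s.stream r (L * w) k = s.stream r (L * w') k :=
  stream_row_congr s r fun _ hj => mul_row_congr_of_isLowerTriangular hL fun l hl =>
    h l (hl.trans_lt (hj.trans_le hk))

/-- The shift `V x` of the noise caused by the rows `x` that `s` chooses, and its change when they
are chosen by `s'` instead, when the released rows are those of `L w`. -/
def Strategy.shift {R : Type} [MeasurableSpace R] (s s' : Strategy n d R)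
    {L V : Matrix (Fin n) (Fin n) ℝ} (hL : L.IsLowerTriangular) (hV : V.IsLowerTriangular) :
    AdaptiveShift R n d where
  base := fun r (w : DataStream n d) => V * s.stream r (L * w)
  diff := fun r (w : DataStream n d) => V * (s'.stream r (L * w) - s.stream r (L * w))
  measurable_base := (measurable_const_mul_matrix V).comp ((measurable_stream s).comp
    (measurable_fst.prodMk ((measurable_const_mul_matrix L).comp measurable_snd)))
  measurable_diff := by
    have response (u : Strategy n d R) :
        Measurable fun q : R × DataStream n d => u.stream q.1 (L * q.2) :=
      (measurable_stream u).comp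
        (measurable_fst.prodMk ((measurable_const_mul_matrix L).comp measurable_snd))
    exact (measurable_const_mul_matrix V).comp ((response s').sub (response s))
  strictlyCausal_base r _ _ _ h := mul_row_congr_of_isLowerTriangular hV fun _ hk =>
    stream_mul_row_congr s r hL hk h
  strictlyCausal_diff r _ _ _ h := mul_row_congr_of_isLowerTriangular hV fun _ hk =>
    congrArg₂ (· - ·) (stream_mul_row_congr s' r hL hk h) (stream_mul_row_congr s r hL hk h)

section Simulation

variable {R : Type} [MeasurableSpace R] (s s' : Strategy n d R) {L V : Matrix (Fin n) (Fin n) ℝ}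
  (hL : L.IsLowerTriangular) (hV : V.IsLowerTriangular)

lemma isResponse_shift {u : Strategy n d R} {r : R} {t : ℝ}
    (hu : ∀ y, u.stream r y = s.stream r y + t • (s'.stream r y - s.stream r y)) :
    (s.shift s' hL hV).IsResponse r t fun G : Matrix (Fin n) (Fin d) ℝ =>
      V * u.stream r (transcript (matrixMechanism L V) u r G n) + G where
  measurable := ((measurable_const_mul_matrix V).comp ((measurable_stream u).of_uncurry_left.comp
    (measurable_transcript (measurable_matrixMechanism L V) u n).of_uncurry_left)).add measurable_id
  eq_add (G : Matrix (Fin n) (Fin d) ℝ) := by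
    set y := transcript (matrixMechanism L V) u r G n
    have hy : y = L * (V * u.stream r y + G) := transcript_matrixMechanism (hL.mul hV) u r G
    have hw : V * u.stream r y + G = V * s.stream r (L * (V * u.stream r y + G)) +
        t • (V * (s'.stream r (L * (V * u.stream r y + G)) -
          s.stream r (L * (V * u.stream r y + G)))) + G := by
      rw [← hy, hu, Matrix.mul_add, Matrix.mul_smul]
    exact hw

lemma measurable_mul_simulate (m : ℝ) :
    Measurable fun q : R × (ℝ × (Fin n → Fin d → ℝ)) =>
      (q.1, L * Matrix.of ((s.shift s' hL hV).simulate q.1 m q.2)) :=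
  measurable_fst.prodMk ((measurable_const_mul_matrix L).comp
    (AdaptiveShift.measurable_simulate _ measurable_fst measurable_const measurable_snd))

lemma viewLaw_eq_map_simulate (seed : Measure R) [SFinite seed] {m : ℝ}
    (hm : ∀ r y, frobeniusNorm (V * (s'.stream r y - s.stream r y)) ≤ m) {t : ℝ}
    {u : Strategy n d R}
    (hu : ∀ r y, u.stream r y = s.stream r y + t • (s'.stream r y - s.stream r y)) :
    viewLaw seed (gaussianMatrix n d v) (matrixMechanism L V) u =
      (seed.prod ((gaussianReal (t * m) v).prod (gaussianMatrix n d v))).map fun q =>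
        (q.1, L * Matrix.of ((s.shift s' hL hV).simulate q.1 m q.2)) := by
  refine map_prod_congr seed (measurable_view (measurable_matrixMechanism L V) u)
    (measurable_mul_simulate s s' hL hV m) fun r => ?_
  have measurable_output : Measurable fun w : Fin n → Fin d → ℝ => (r, L * Matrix.of w) :=
    measurable_const.prodMk (measurable_const_mul_matrix L)
  have shift_le (w) : ∑ i, (s.shift s' hL hV).diff r w i ⬝ᵥ (s.shift s' hL hV).diff r w i ≤ m ^ 2 :=
    (sum_dotProduct_self_eq_frobeniusNorm_sq _).trans_le
      (pow_le_pow_left₀ (frobeniusNorm_nonneg _) (hm r _) 2)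
  have response := isResponse_shift s s' hL hV (hu r)
  have simulated := congrArg (Measure.map fun w => (r, L * Matrix.of w))
    ((s.shift s' hL hV).map_simulate v r shift_le response)
  rw [Measure.map_map measurable_output (by fun_prop),
    Measure.map_map measurable_output response.measurable] at simulated
  have response_output : ((fun w => (r, L * Matrix.of w)) ∘ fun G : Matrix (Fin n) (Fin d) ℝ =>
      V * u.stream r (transcript (matrixMechanism L V) u r G n) + G) =
        fun G => (r, transcript (matrixMechanism L V) u r G n) :=
    funext fun G => Prod.ext rfl (transcript_matrixMechanism (hL.mul hV) u r G).symm
  exact (simulated.trans (congrArg (Measure.map · _) response_output)).symm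

end Simulation

theorem adaptivelyPrivate_of_gaussianReal (hpriv : priv.IsStable) {L V : Matrix (Fin n) (Fin n) ℝ}
    (hL : L.IsLowerTriangular) (hV : V.IsLowerTriangular) {m : ℝ}
    (hm : ∀ x x', (x, x') ∈ N → frobeniusNorm (V * (x' - x)) ≤ m)
    (h : priv ℝ (gaussianReal 0 v) (gaussianReal m v)) :
    AdaptivelyPrivate priv N (gaussianMatrix n d v) (matrixMechanism L V) := by
  intro R _ seed _ s s' hs
  have shift_le (r y) := hm (s.stream r y) (s'.stream r y) (hs r y)
  rw [viewLaw_eq_map_simulate s s' hL hV seed shift_le (t := 0) (by simp),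
    viewLaw_eq_map_simulate s s' hL hV seed shift_le (t := 1) (by simp), zero_mul, one_mul]
  have joint := hpriv.map measurable_swap (hpriv.prod seed (hpriv.prod (gaussianMatrix n d v) h))
  rw [Measure.prod_swap, Measure.prod_swap] at joint
  exact hpriv.map (measurable_mul_simulate s s' hL hV m) joint

lemma PrivacyNotion.IsTrivial.adaptivelyPrivate (hpriv : priv.IsTrivial) {W : Type}
    [MeasurableSpace W] (noise : Measure W) [IsProbabilityMeasure noise]
    {M : W → DataStream n d → DataStream n d} (hM : Measurable (Function.uncurry M)) :
    AdaptivelyPrivate priv N noise M := by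
  intro R _ seed _ s s' _
  have (u : Strategy n d R) : IsProbabilityMeasure (viewLaw seed noise M u) :=
    Measure.isProbabilityMeasure_map (measurable_view hM u).aemeasurable
  exact hpriv _ _ _

theorem adaptivelyPrivate_of_isLowerTriangular (hpriv : priv.IsStable)
    {L K : Matrix (Fin n) (Fin n) ℝ} (hL : L.IsLowerTriangular) (hV : (Lᵀ * K).IsLowerTriangular)
    (h : NonadaptivelyPrivate priv N (gaussianMatrix n d v) (matrixMechanism L (Lᵀ * K))) :
    AdaptivelyPrivate priv N (gaussianMatrix n d v) (matrixMechanism L (Lᵀ * K)) := by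
  set S : Set ℝ := (fun x => frobeniusNorm (Lᵀ * K * (x.2 - x.1))) '' N
  have gaussian_of_mem : ∀ m ∈ S, priv ℝ (gaussianReal 0 v) (gaussianReal m v) := by
    rintro _ ⟨x, hx, rfl⟩
    exact h.gaussianReal_frobeniusNorm hpriv hx
  obtain hN | hN := N.eq_empty_or_nonempty
  · intro R _ seed _ s s' hs
    exact absurd (hs seed.nonempty_of_neZero.some 0) (by simp [hN])
  obtain htrivial | ⟨hbdd, hsup⟩ :=
    hpriv.isTrivial_or_gaussianReal_sSup (hN.image _) gaussian_of_mem
  · exact htrivial.adaptivelyPrivate _ (measurable_matrixMechanism _ _)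
  · exact adaptivelyPrivate_of_gaussianReal hpriv hL hV
      (fun x x' hx => le_csSup hbdd ⟨(x, x'), hx, rfl⟩) hsup

end Adaptivity

end ContinualRelease

theorem mainTheorem6_general {priv : PrivacyNotion} (hpriv : priv.IsStable) {n p d : ℕ}
    {B : Matrix (Fin n) (Fin p) ℝ} {C : Matrix (Fin p) (Fin n) ℝ} (hA : (B * C).IsLowerTriangular)
    {N : Set (DataStream n d × DataStream n d)} {v : ℝ≥0}
    (h : NonadaptivelyPrivate priv N (gaussianMatrix p d v) (matrixMechanism B C)) :
    AdaptivelyPrivate priv N (gaussianMatrix p d v) (matrixMechanism B C) := by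
  obtain ⟨L, V, K, hL, hV, hcov, hprod, rfl⟩ := exists_isLowerTriangular_factorization hA
  rw [nonadaptivelyPrivate_matrixMechanism_iff, map_mul_gaussianMatrix_eq_of_mul_transpose_eq hcov,
    hprod, ← nonadaptivelyPrivate_matrixMechanism_iff] at h
  rw [adaptivelyPrivate_matrixMechanism_iff, map_mul_gaussianMatrix_eq_of_mul_transpose_eq hcov,
    hprod, ← adaptivelyPrivate_matrixMechanism_iff]
  exact adaptivelyPrivate_of_isLowerTriangular hpriv hL hV h

theorem mainTheorem6 {n p d : ℕ} (A : Matrix (Fin n) (Fin n) ℝ)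
    (B : Matrix (Fin n) (Fin p) ℝ) (C : Matrix (Fin p) (Fin n) ℝ)
    (hA : A.IsLowerTriangular) (hrank : A.rank = n) (hBC : A = B * C)
    (N : Set (DataStream n d × DataStream n d)) (κ σ : ℝ)
    (hκ : ∀ x x' : DataStream n d, (x, x') ∈ N → frobeniusNorm (C * (x - x')) ≤ κ) :
    (∀ ε δ : ℝ≥0,
      NonadaptivelyPrivate (approxDP ε δ) N
        (gaussianMatrix p d (Real.toNNReal (κ ^ 2 * σ ^ 2))) (matrixMechanism B C) →
      AdaptivelyPrivate (approxDP ε δ) N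
        (gaussianMatrix p d (Real.toNNReal (κ ^ 2 * σ ^ 2))) (matrixMechanism B C)) ∧
    (∀ ρ : ℝ≥0,
      NonadaptivelyPrivate (zCDP ρ) N
        (gaussianMatrix p d (Real.toNNReal (κ ^ 2 * σ ^ 2))) (matrixMechanism B C) →
      AdaptivelyPrivate (zCDP ρ) N
        (gaussianMatrix p d (Real.toNNReal (κ ^ 2 * σ ^ 2))) (matrixMechanism B C)) ∧
    (∀ μ : ℝ≥0,
      NonadaptivelyPrivate (gaussianDP μ) N
        (gaussianMatrix p d (Real.toNNReal (κ ^ 2 * σ ^ 2))) (matrixMechanism B C) →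
      AdaptivelyPrivate (gaussianDP μ) N
        (gaussianMatrix p d (Real.toNNReal (κ ^ 2 * σ ^ 2))) (matrixMechanism B C)) := by
  subst hBC
  exact ⟨fun ε δ => mainTheorem6_general (approxDP_isStable ε δ) hA,
    fun ρ => mainTheorem6_general (zCDP_isStable ρ) hA,
    fun μ => mainTheorem6_general (gaussianDP_isStable μ) hA⟩
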